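/- **Theorem (Ball carving algorithm).** Consider the deterministic $\mathsf{CONGEST}$ model: on each vertex of an $n$-vertex graph $G=(V,E)$, $n\ge 2$, there is a processor; in every synchronous round each vertex may send one message of at most $B$ bits to each of its neighbors, and local computation is unrestricted. Initially a vertex $v$ knows only its degree (its neighbors being distinguished by arbitrary local port numbers), its own unique $b$-bit identifier, whether it belongs to a given set $S\subseteq V$ of living vertices, and the global parameters $b$, $B$ and an estimate $N$ of $n$. For every constant $c$ there is a constant $K$, depending only on $c$, such that for all $N,b,B$ there is a deterministic $\mathsf{CONGEST}$ algorithm with $B$-bit messages with the following property. For every graph $G=(V,E)$ with $n\ge 2$ vertices such that $n\le N\le n^{c}$, $b\le c\lceil\log_2 n\rceil$ and $\lceil\log_2 n\rceil\le cB$, every port numbering, every assignment of distinct $b$-bit identifiers to the vertices, and every $S\subseteq V$, the algorithm stops after at most $K\lceil\log_2 n\rceil^{4}=O(\log^4 n)$ rounds, and its output describes a set $S'\subseteq S$ with $|S'|\ge |S|/2$, a partition of $S'$ into clusters, and for each cluster $\mathcal C$ a subgraph $T_{\mathcal C}$ of $G$, such that: 1. no edge of $G$ joins two different clusters; 2. each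 cluster has weak diameter at most $K\lceil\log_2 n\rceil^2=O(\log^2 n)$, i.e. any two of its vertices are at distance at most this in $G$; 3. for each (nonempty) cluster $\mathcal C$, $T_{\mathcal C}$ is a Steiner tree with set of terminals $\mathcal C$, i.e. a tree whose vertex set contains $\mathcal C$, and it has radius at most $K\lceil\log_2 n\rceil^2=O(\log^2 n)$; 4. each vertex of $G$ lies in at most $K\lceil\log_2 n\rceil=O(\log n)$ of the trees. The output is distributed: each vertex computes whether it lies in $S'$ and, if so, the label of its cluster, as well as the list of the labels $\mathcal C$ for which it lies in $T_{\mathcal C}$ together with its parent (if any) in each of these trees; the edges of $T_{\mathcal C}$ are the pairs of a vertex and its parent. -/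

import Mathlib

/-- Port numbers for the vertices of a graph: the neighbours of `v` are numbered by
`0, …, deg v - 1`, in an arbitrary order. Since `port v` is a bijection, `deg v` is
the degree of `v`. -/
structure PortNumbering {V : Type*} (G : SimpleGraph V) where
  deg : V → ℕ
  port : ∀ v, Fin (deg v) ≃ G.neighborSet v

namespace PortNumbering

variable {V : Type*} {G : SimpleGraph V} (P : PortNumbering G)

/-- The neighbour of `v` behind its port `i`. -/
def nbr (v : V) (i : Fin (P.deg v)) : V := (P.port v i : V)

theorem adj_nbr (v : V) (i : Fin (P.deg v)) : G.Adj v (P.nbr v i) := (P.port v i).2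

/-- The port through which the neighbour of `v` behind port `i` sees `v`. -/
def back (v : V) (i : Fin (P.deg v)) : Fin (P.deg (P.nbr v i)) :=
  (P.port (P.nbr v i)).symm ⟨v, (P.adj_nbr v i).symm⟩

end PortNumbering

/-- A deterministic synchronous message passing algorithm with messages of at most `B` bits
(the CONGEST model). Every node runs the same algorithm. A node initially knows only its degree
`d` and its local input; it distinguishes its neighbours only by its port numbers. Per round it
sends one message (a bit string of length at most `B`, the empty string being silence) through
each of its ports, and then updates its state from the messages that it receives. After
`rounds` rounds all nodes stop, and each of them computes its local output from its own state.
Local computation is not restricted. -/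
structure CongestAlgorithm (B : ℕ) (Input : Type) (Output : ℕ → Type) where
  State : ℕ → Type
  init : ∀ d : ℕ, Input → State d
  send : ∀ d : ℕ, State d → Fin d → List Bool
  length_send_le : ∀ (d : ℕ) (s : State d) (i : Fin d), (send d s i).length ≤ B
  step : ∀ d : ℕ, State d → (Fin d → List Bool) → State d
  output : ∀ d : ℕ, State d → Output d
  rounds : ℕ

namespace CongestAlgorithm

variable {B : ℕ} {Input : Type} {Output : ℕ → Type} {V : Type*} {G : SimpleGraph V}

/-- The state of each node after `t` rounds, when the algorithm is run on the network `G` with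
port numbering `P` and local inputs `x`. -/
def stateAfter (A : CongestAlgorithm B Input Output) (P : PortNumbering G) (x : V → Input) :
    ℕ → ∀ v : V, A.State (P.deg v)
  | 0 => fun v => A.init (P.deg v) (x v)
  | t + 1 => fun v =>
      A.step (P.deg v) (stateAfter A P x t v)
        (fun i => A.send (P.deg (P.nbr v i)) (stateAfter A P x t (P.nbr v i)) (P.back v i))

/-- The local outputs at the end of the run. -/
def run (A : CongestAlgorithm B Input Output) (P : PortNumbering G) (x : V → Input) (v : V) :
    Output (P.deg v) :=
  A.output (P.deg v) (A.stateAfter P x A.rounds v)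

end CongestAlgorithm

namespace BallCarving

/-- What a node knows initially, besides its degree: its identifier, and whether it belongs to
the set of living vertices. -/
structure LocalInput where
  ident : ℕ
  living : Bool

/-- The part of the output that a node of degree `d` computes.
* `cluster` is the label of the cluster of the node, or `none` if the node is not clustered.
* `tree ℓ` is `none` if the node does not lie in the Steiner tree of the cluster labelled `ℓ`;
  it is `some none` if the node lies in this tree and has no parent there, and `some (some i)`
  if the node lies in this tree and its parent there is the neighbour behind its port `i`. -/
structure LocalOutput (d : ℕ) where
  cluster : Option ℕ
  tree : ℕ → Option (Option (Fin d))

section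

variable {V : Type*} {G : SimpleGraph V} {P : PortNumbering G}
  (out : ∀ v : V, LocalOutput (P.deg v))

/-- The set of clustered vertices. -/
def clustered : Set V := {v | (out v).cluster ≠ none}

/-- The cluster with label `ℓ`. -/
def cluster (ℓ : ℕ) : Set V := {v | (out v).cluster = some ℓ}

/-- `u` regards `v` as its parent in the tree labelled `ℓ`. -/
def IsParent (ℓ : ℕ) (u v : V) : Prop :=
  ∃ i : Fin (P.deg u), (out u).tree ℓ = some (some i) ∧ P.nbr u i = v

theorem IsParent.adj {out : ∀ v : V, LocalOutput (P.deg v)} {ℓ : ℕ} {u v : V}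
    (h : IsParent out ℓ u v) : G.Adj u v := by
  obtain ⟨i, -, rfl⟩ := h
  exact P.adj_nbr u i

/-- The subgraph of `G` which the outputs describe for label `ℓ`: its vertices are the nodes that
declare to lie in it, its edges join the nodes to their parents. -/
def steinerGraph (ℓ : ℕ) : G.Subgraph where
  verts := {v | (out v).tree ℓ ≠ none}
  Adj u v := ((out u).tree ℓ ≠ none ∧ (out v).tree ℓ ≠ none) ∧
    (IsParent out ℓ u v ∨ IsParent out ℓ v u)
  adj_sub h := h.2.elim (fun h => h.adj) (fun h => h.adj.symm)
  edge_vert h := h.1.1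
  symm := ⟨fun _ _ h => ⟨h.1.symm, h.2.symm⟩⟩

end

/-- `T` is a Steiner tree in `G` with set of terminals `C`. -/
def IsSteinerTree {V : Type*} {G : SimpleGraph V} (T : G.Subgraph) (C : Set V) : Prop :=
  T.coe.IsTree ∧ C ⊆ T.verts

/-- The outputs describe a ball carving of the set `S` of living vertices in `G`, with clusters of
weak diameter at most `D`, and with Steiner trees of radius at most `R` such that each vertex lies
in at most `M` of them. Clusters with different labels are disjoint by construction. -/
structure IsBallCarving {V : Type*} {G : SimpleGraph V} {P : PortNumbering G} (S : Set V)
    (out : ∀ v : V, LocalOutput (P.deg v)) (D R M : ℕ) : Prop where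
  subset : clustered out ⊆ S
  half : S.ncard ≤ 2 * (clustered out).ncard
  nonadjacent : ∀ ℓ ℓ' : ℕ, ℓ ≠ ℓ' →
    ∀ u ∈ cluster out ℓ, ∀ v ∈ cluster out ℓ', ¬ G.Adj u v
  weakDiam : ∀ ℓ : ℕ, ∀ u ∈ cluster out ℓ, ∀ v ∈ cluster out ℓ, G.edist u v ≤ (D : ℕ∞)
  steiner : ∀ ℓ : ℕ, (cluster out ℓ).Nonempty →
    IsSteinerTree (steinerGraph out ℓ) (cluster out ℓ) ∧
      (steinerGraph out ℓ).coe.radius ≤ (R : ℕ∞)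
  overlap : ∀ v : V, {ℓ : ℕ | v ∈ (steinerGraph out ℓ).verts}.encard ≤ (M : ℕ∞)

end BallCarving

/-! Every living node starts as a cluster of its own, labelled by its identifier and holding one
token. Clusters have levels, initially 0, and the key of a cluster orders clusters first by level
and then, within level `l`, puts labels with bit `l` set before the others. In a step, each living
node that has a living neighbour of smaller key proposes to the cluster of a neighbour of least key.
A cluster with `T` tokens and `p` proposals accepts all of them if `T ≤ 2hp`, gaining a token for
each; otherwise it rejects them all, the proposers are removed, and it pays `h` tokens for each,
less than half of `T`. After a rejection the cluster is settled: no living neighbour has a larger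
key. A phase consists of `2h` steps, and clusters that rejected in its last step then rise one
level.

Separation: labels of adjacent living nodes agree modulo 2 to the smaller of their levels. A move
goes to a level that is not higher, so it respects this; when two adjacent clusters rise together,
each being settled, their keys are equal and so one more bit agrees.

Progress: over a phase a cluster either accepts throughout and doubles its tokens, or keeps at least
half of them and rises. So tokens times `4 ^ level` at least doubles in each phase (`tokens_phase`).
A move lowers the key of a node and the end of a phase raises it by at most 3, so after `τ` phases a
node has moved at most `3τ + 1` times. This bounds the total number of tokens, and `8b` phases force
all levels up to `b`; then adjacent labels coincide. The conservation law `tokens + h * removed =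
card S + moves` with `h = 52b` leaves at least half of `S`.

Trees: a node joining a cluster hangs itself below the neighbour it proposed to and never leaves the
tree. Depth grows by at most one per step, hence `O(b²)`, and a node lies in at most one tree more
than it made moves, hence `O(b)`.

Communication: a step needs the number of proposals at each root and the decision at each member.
Messages of `O(b)` bits carry one bit per tree, so a pipelined bit-serial addition up the trees
(`bitSerial_sum`) and a broadcast down take `O(b²)` rounds; over `O(b²)` steps this is `O(b⁴)`. Wide
messages are cut into pieces of `B` bits. -/

/-! ### Simulating rounds with wide messages in the CONGEST model. -/

/-- One round of a message passing protocol whose nodes of degree `d` have states in `St d`, with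
messages from a type that can be encoded by `w` bits. -/
structure Round (w : ℕ) (St : ℕ → Type) where
  Msg : Type
  [fintype : Fintype Msg]
  [nonempty : Nonempty Msg]
  card_le : Fintype.card Msg ≤ 2 ^ w
  send : ∀ d, St d → Fin d → Msg
  step : ∀ d, St d → (Fin d → Msg) → St d

namespace Round

attribute [instance] Round.fintype Round.nonempty

variable {w : ℕ} {St : ℕ → Type} {V : Type*} {G : SimpleGraph V}

/-- The effect of a round on the states of all nodes. -/
def exec (r : Round w St) (P : PortNumbering G) (σ : ∀ v, St (P.deg v)) : ∀ v, St (P.deg v) :=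
  fun v => r.step _ (σ v) fun i => r.send _ (σ (P.nbr v i)) (P.back v i)

/-- The effect of a sequence of rounds on the states of all nodes. -/
def execList (rs : List (Round w St)) (P : PortNumbering G) (σ : ∀ v, St (P.deg v)) :
    ∀ v, St (P.deg v) :=
  rs.foldl (fun σ r => r.exec P σ) σ

@[simp] theorem execList_nil (P : PortNumbering G) (σ : ∀ v, St (P.deg v)) :
    execList ([] : List (Round w St)) P σ = σ := rfl

@[simp] theorem execList_cons (r : Round w St) (rs : List (Round w St)) (P : PortNumbering G)
    (σ : ∀ v, St (P.deg v)) : execList (r :: rs) P σ = execList rs P (r.exec P σ) := rfl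

theorem execList_append (rs rs' : List (Round w St)) (P : PortNumbering G)
    (σ : ∀ v, St (P.deg v)) : execList (rs ++ rs') P σ = execList rs' P (execList rs P σ) := by
  simp [execList]

theorem exists_encoding (r : Round w St) :
    ∃ e : r.Msg → List Bool, Function.Injective e ∧ ∀ m, (e m).length = w := by
  have : Fintype.card r.Msg ≤ Fintype.card (Fin w → Bool) := by simpa using r.card_le
  obtain ⟨f⟩ := Function.Embedding.nonempty_of_card_le this
  exact ⟨fun m => List.ofFn (f m), fun a b h => f.injective (List.ofFn_injective h), by simp⟩

/-- An encoding of the messages by bit strings. -/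
noncomputable def enc (r : Round w St) : r.Msg → List Bool := r.exists_encoding.choose

theorem enc_injective (r : Round w St) : Function.Injective r.enc :=
  r.exists_encoding.choose_spec.1

theorem length_enc (r : Round w St) (m : r.Msg) : (r.enc m).length = w :=
  r.exists_encoding.choose_spec.2 m

/-- The inverse of `Round.enc`. -/
noncomputable def dec (r : Round w St) : List Bool → r.Msg := Function.invFun r.enc

theorem dec_enc (r : Round w St) (m : r.Msg) : r.dec (r.enc m) = m :=
  Function.leftInverse_invFun r.enc_injective m

variable {Input : Type} {Output : ℕ → Type}

/-- The CONGEST algorithm that executes a sequence of rounds, each of them in `k` rounds with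
messages of `B` bits. -/
noncomputable def compile (B k : ℕ) (rs : List (Round w St)) (init : ∀ d, Input → St d)
    (output : ∀ d, St d → Output d) : CongestAlgorithm B Input Output where
  -- A clock, the bits of the current wide message received so far at each port, and the simulated
  -- state.
  State d := ℕ × (Fin d → List Bool) × St d
  init d x := (0, fun _ => [], init d x)
  send d s i := match rs[s.1 / k]? with
    | none => []
    | some r => ((r.enc (r.send d s.2.2 i)).drop (s.1 % k * B)).take B
  length_send_le d s i := by
    split <;> simp
  step d s m :=
    if (s.1 + 1) % k = 0 then
      (s.1 + 1, fun _ => [], match rs[s.1 / k]? with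
        | none => s.2.2
        | some r => r.step d s.2.2 fun i => r.dec (s.2.1 i ++ m i))
    else (s.1 + 1, fun i => s.2.1 i ++ m i, s.2.2)
  output d s := output d s.2.2
  rounds := k * rs.length

variable {B k : ℕ} (rs : List (Round w St)) (init : ∀ d, Input → St d)
  (output : ∀ d, St d → Output d) (P : PortNumbering G) (x : V → Input)

/-- Inside a block of `k` rounds the simulated state is frozen, so all pieces are cut from the same
codeword and concatenate to a prefix of it. -/
theorem stateAfter_compile_add {t : ℕ} (ht : t < rs.length) (σ : ∀ v, St (P.deg v))
    (h : ∀ v, (compile B k rs init output).stateAfter P x (k * t) v = (k * t, fun _ => [], σ v))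
    {j : ℕ} (hj : j < k) (v : V) :
    (compile B k rs init output).stateAfter P x (k * t + j) v =
      (k * t + j, fun i => (rs[t].enc (rs[t].send _ (σ (P.nbr v i)) (P.back v i))).take (j * B),
        σ v) := by
  induction j generalizing v with
  | zero => simpa using h v
  | succ j ih =>
    have hj' : j < k := by omega
    have h1 : (k * t + j) / k = t := by
      rw [Nat.mul_add_div (by omega), Nat.div_eq_of_lt hj', add_zero]
    have h2 : (k * t + j) % k = j := by
      rw [Nat.mul_add_mod, Nat.mod_eq_of_lt hj']
    have h3 : (k * t + j + 1) % k = j + 1 := by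
      rw [add_assoc, Nat.mul_add_mod, Nat.mod_eq_of_lt hj]
    rw [← add_assoc, CongestAlgorithm.stateAfter]
    simp only [ih hj']
    simp only [compile, h1, h2, h3, List.getElem?_eq_getElem ht]
    simp [Nat.succ_mul, List.take_add]

theorem stateAfter_compile (hk : 0 < k) (hw : w ≤ k * B) {t : ℕ} (ht : t ≤ rs.length) (v : V) :
    (compile B k rs init output).stateAfter P x (k * t) v =
      (k * t, fun _ => [], execList (rs.take t) P (fun v => init _ (x v)) v) := by
  induction t generalizing v with
  | zero => rfl
  | succ t ih =>
    have ht' : t < rs.length := by omega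
    have key := fun v => stateAfter_compile_add rs init output P x ht' _ (ih ht'.le)
      (Nat.sub_one_lt_of_lt hk) v
    -- The last round of the block is separate: it completes the codeword, decodes it and empties
    -- the buffer.
    have h0 : k * (t + 1) = k * t + (k - 1) + 1 := by rw [Nat.mul_succ]; omega
    have h1 : (k * t + (k - 1)) / k = t := by
      rw [Nat.mul_add_div hk, Nat.div_eq_of_lt (by omega), add_zero]
    have h2 : (k * t + (k - 1)) % k = k - 1 := by
      rw [Nat.mul_add_mod, Nat.mod_eq_of_lt (by omega)]
    have h3 : (k * t + (k - 1) + 1) % k = 0 := by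
      rw [← h0, Nat.mul_mod_right]
    rw [h0, CongestAlgorithm.stateAfter]
    simp only [key]
    simp only [compile, h1, h2, h3, List.getElem?_eq_getElem ht']
    have h4 : (k - 1) * B + B = k * B := by
      rw [← Nat.succ_mul, Nat.succ_eq_add_one, Nat.sub_add_cancel hk]
    simp only [← List.take_add, h4, if_true]
    rw [List.take_add_one, List.getElem?_eq_getElem ht', Option.toList_some, execList_append]
    simp only [execList_cons, execList_nil, exec]
    congr 3
    refine funext fun i => ?_
    rw [List.take_of_length_le (by rw [length_enc]; exact hw), dec_enc]

theorem run_compile (hk : 0 < k) (hw : w ≤ k * B) (v : V) :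
    (compile B k rs init output).run P x v =
      output _ (execList rs P (fun v => init _ (x v)) v) := by
  have := stateAfter_compile rs init output P x hk hw le_rfl v
  rw [List.take_length] at this
  exact congrArg (fun s => output _ s.2.2) this

end Round

/-! ### Counting over ports. -/

namespace PortNumbering

variable {V : Type*} {G : SimpleGraph V} (P : PortNumbering G)

theorem nbr_injective (v : V) : Function.Injective (P.nbr v) := fun _ _ h =>
  (P.port v).injective (Subtype.ext h)

theorem nbr_back (v : V) (i : Fin (P.deg v)) : P.nbr (P.nbr v i) (P.back v i) = v :=
  congrArg Subtype.val ((P.port (P.nbr v i)).apply_symm_apply _)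

theorem exists_nbr_eq {v w : V} (h : G.Adj v w) : ∃ i, P.nbr v i = w :=
  ⟨(P.port v).symm ⟨w, h⟩, by simp [nbr]⟩

-- A receiver counts over its own ports, whereas the analysis counts senders; `back` matches the
-- two.
open Classical in
theorem card_ports [Fintype V] (w : V) (p : ∀ v, Fin (P.deg v) → Prop) :
    (Finset.univ.filter fun i => p (P.nbr w i) (P.back w i)).card =
      (Finset.univ.filter fun v => ∃ i, p v i ∧ P.nbr v i = w).card := by
  refine Finset.card_bij (fun i _ => P.nbr w i) ?_ (fun _ _ _ _ h => P.nbr_injective w h) ?_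
  · intro i hi
    simp only [Finset.mem_filter, Finset.mem_univ, true_and] at hi ⊢
    exact ⟨_, hi, P.nbr_back w i⟩
  · intro v hv
    simp only [Finset.mem_filter, Finset.mem_univ, true_and] at hv
    obtain ⟨i, hi, rfl⟩ := hv
    refine ⟨P.back v i, ?_, P.nbr_back v i⟩
    simp only [Finset.mem_filter, Finset.mem_univ, true_and]
    -- The type of a port depends on its vertex, and going back and forth returns to `v` only
    -- propositionally; hence the generalization over `u`.
    have h : ∀ (u : V) (k : Fin (P.deg u)), u = v → P.nbr u k = P.nbr v i → p u k := by
      rintro u k rfl h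
      rwa [P.nbr_injective u h]
    exact h _ _ (P.nbr_back v i) (P.nbr_back _ _)

end PortNumbering

/-! ### Bit-serial addition along a tree. -/

open Classical in
/-- Bit-serial addition along a rooted tree: in each round, every node adds the bits that it gets
from its children to its carry, keeps the last bit of the result for its parent, and half of
the rest as its new carry. The root collects the binary digits of the sum. -/
theorem bitSerial_sum {ι : Type*} (A : Finset ι) (dep : ι → ℕ) (IsPar : ι → ι → Prop) (root : ι)
    (D : ℕ) (hroot : root ∈ A) (hdep : dep root = 0) (hle : ∀ x ∈ A, dep x ≤ D)
    (hpar_root : ∀ y ∈ A, ¬ IsPar root y)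
    (hpar : ∀ x ∈ A, x ≠ root → ∃ y ∈ A, ∀ z ∈ A, IsPar x z ↔ z = y)
    (hpar_dep : ∀ x ∈ A, ∀ y ∈ A, IsPar x y → dep x = dep y + 1)
    (X : ι → ℕ) (carry out : ℕ → ι → ℕ) (acc : ℕ → ℕ)
    (hcarry0 : ∀ x ∈ A, carry 0 x = X x * 2 ^ (D - dep x)) (hout0 : ∀ x ∈ A, out 0 x = 0)
    (hacc0 : acc 0 = 0) (U : ℕ)
    (hstep : ∀ t < U, ∀ x ∈ A, 2 * carry (t + 1) x + out (t + 1) x =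
      carry t x + ∑ y ∈ A, if IsPar y x then out t y else 0)
    (hacc : ∀ t < U, acc (t + 1) = acc t + out (t + 1) root * 2 ^ t)
    (hU : 2 ^ D * ∑ x ∈ A, X x < 2 ^ U) :
    acc U = 2 ^ D * ∑ x ∈ A, X x := by
  -- Conservation of value. A bit emitted at depth `d` reaches the root `d` rounds later, so a unit
  -- of carry at time `t` is worth `2 ^ (t + d)`. The initial factor `2 ^ (D - d)` makes all
  -- summands worth `2 ^ D` each.
  have key : ∀ t ≤ U, ∑ x ∈ A, carry t x * 2 ^ (t + dep x) +
      ∑ x ∈ A.erase root, out t x * 2 ^ (t + dep x - 1) + acc t = 2 ^ D * ∑ x ∈ A, X x := by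
    intro t
    induction t with
    | zero =>
      intro _
      rw [hacc0, Finset.mul_sum, Finset.sum_eq_zero (s := A.erase root)
        (fun x hx => by rw [hout0 x (Finset.mem_of_mem_erase hx), zero_mul]), add_zero, add_zero]
      refine Finset.sum_congr rfl fun x hx => ?_
      rw [hcarry0 x hx, zero_add, mul_assoc, ← pow_add, Nat.sub_add_cancel (hle x hx), mul_comm]
    | succ t ih =>
      intro ht
      rw [← ih (by omega), hacc t (by omega)]
      have e1 : ∑ x ∈ A, carry (t + 1) x * 2 ^ (t + 1 + dep x) +
          ∑ x ∈ A, out (t + 1) x * 2 ^ (t + dep x) =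
          ∑ x ∈ A, (carry t x + ∑ y ∈ A, if IsPar y x then out t y else 0) * 2 ^ (t + dep x) := by
        rw [← Finset.sum_add_distrib]
        refine Finset.sum_congr rfl fun x hx => ?_
        rw [← hstep t (by omega) x hx]
        ring
      have e2 : ∑ x ∈ A, out (t + 1) x * 2 ^ (t + dep x) =
          ∑ x ∈ A.erase root, out (t + 1) x * 2 ^ (t + 1 + dep x - 1) +
            out (t + 1) root * 2 ^ t := by
        rw [← Finset.sum_erase_add _ _ hroot, hdep, add_zero]
        congr 1
        refine Finset.sum_congr rfl fun x _ => ?_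
        rw [show t + 1 + dep x - 1 = t + dep x by omega]
      -- Each bit in transit is received once, by the unique parent, one level up.
      have e3 : ∑ x ∈ A, (∑ y ∈ A, if IsPar y x then out t y else 0) * 2 ^ (t + dep x) =
          ∑ y ∈ A.erase root, out t y * 2 ^ (t + dep y - 1) := by
        simp_rw [Finset.sum_mul]
        rw [Finset.sum_comm, ← Finset.sum_erase_add _ _ hroot]
        rw [Finset.sum_eq_zero (s := A) (fun x hx => by
          rw [if_neg (hpar_root x hx), zero_mul]), add_zero]
        refine Finset.sum_congr rfl fun y hy => ?_
        obtain ⟨hne, hy⟩ := Finset.mem_erase.1 hy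
        obtain ⟨z, hz, hz'⟩ := hpar y hy hne
        rw [Finset.sum_eq_single_of_mem z hz]
        · have hyz := (hz' z hz).2 rfl
          rw [if_pos hyz, hpar_dep y hy z hz hyz, ← add_assoc, Nat.add_sub_cancel]
        · intro x hx hxz
          rw [if_neg (fun h => hxz ((hz' x hx).1 h)), zero_mul]
      simp_rw [add_mul] at e1
      rw [Finset.sum_add_distrib, e3, e2] at e1
      omega
  have hU' := key U le_rfl
  -- Anything still on its way at time `U` would be worth at least `2 ^ U`, more than the total.
  have c0 : ∑ x ∈ A, carry U x * 2 ^ (U + dep x) = 0 := by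
    refine Finset.sum_eq_zero fun x hx => ?_
    by_contra hne
    have h1 := Finset.single_le_sum (f := fun x => carry U x * 2 ^ (U + dep x))
      (fun _ _ => Nat.zero_le _) hx
    have h2 : 2 ^ U ≤ carry U x * 2 ^ (U + dep x) :=
      (Nat.pow_le_pow_right two_pos (Nat.le_add_right _ _)).trans
        (Nat.le_mul_of_pos_left _ (Nat.pos_of_ne_zero fun h => hne (by rw [h, zero_mul])))
    omega
  have o0 : ∑ x ∈ A.erase root, out U x * 2 ^ (U + dep x - 1) = 0 := by
    refine Finset.sum_eq_zero fun x hx => ?_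
    by_contra hne
    have h1 := Finset.single_le_sum (f := fun x => out U x * 2 ^ (U + dep x - 1))
      (fun _ _ => Nat.zero_le _) hx
    obtain ⟨hxr, hx⟩ := Finset.mem_erase.1 hx
    obtain ⟨z, hz, hz'⟩ := hpar x hx hxr
    have hd := hpar_dep x hx z hz ((hz' z hz).2 rfl)
    have h2 : 2 ^ U ≤ out U x * 2 ^ (U + dep x - 1) :=
      (Nat.pow_le_pow_right two_pos (by omega)).trans
        (Nat.le_mul_of_pos_left _ (Nat.pos_of_ne_zero fun h => hne (by rw [h, zero_mul])))
    omega
  rw [← hU', c0, o0]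
  omega

/-! ### The state of a node and one step of the ball carving. -/

namespace BallCarving

/-- What a node tells its neighbours about itself: whether it is alive, the label and the level of
its cluster, the index of the cluster's tree in its own list of trees, and its depth there. -/
structure Info where
  alive : Bool
  lab : ℕ
  lev : ℕ
  slot : ℕ
  dep : ℕ

/-- Nodes join adjacent clusters of smaller key. -/
def Info.key (x : Info) : ℕ := 2 * x.lev + if x.lab.testBit x.lev then 0 else 1

/-- What a node of degree `d` remembers between the steps. It lies in `num` trees, its current
cluster being that of the tree number `cur`. The tree number `j` has label `lab j`, the node has
depth `dep j` there, and `par j` tells the port of its parent together with the number which the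
tree has at the parent. `lev` is the level of the current cluster, `ok` its last decision;
`rootLev`, `rootOk` and `tokens` concern the cluster whose label is the identifier of the node. -/
structure Core (d : ℕ) where
  ident : ℕ
  alive : Bool
  num : ℕ
  cur : ℕ
  lab : ℕ → ℕ
  dep : ℕ → ℕ
  par : ℕ → Option (Fin d × ℕ)
  lev : ℕ
  rootLev : ℕ
  tokens : ℕ
  moves : ℕ
  ok : Bool
  rootOk : Bool

namespace Core

variable {d : ℕ}

/-- In the beginning each living node is a cluster with one token. -/
def start (d : ℕ) (x : LocalInput) : Core d where
  ident := x.ident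
  alive := x.living
  num := 1
  cur := 0
  lab _ := x.ident
  dep _ := 0
  par _ := none
  lev := 0
  rootLev := 0
  tokens := if x.living then 1 else 0
  moves := 0
  ok := true
  rootOk := true

/-- What the node tells its neighbours. -/
def info (c : Core d) : Info := ⟨c.alive, c.lab c.cur, c.lev, c.cur, c.dep c.cur⟩

open Classical in
/-- Join the cluster of the neighbour behind port `i`, whose data is `x`. -/
noncomputable def join (c : Core d) (i : Fin d) (x : Info) : Core d :=
  -- A node that returns to a cluster is still in its tree, and keeps its old parent and depth
  -- there.
  if h : ∃ j, j < c.num ∧ c.lab j = x.lab then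
    { c with cur := Nat.find h, lev := x.lev, moves := c.moves + 1, ok := true }
  else
    { c with
      num := c.num + 1
      cur := c.num
      lab := Function.update c.lab c.num x.lab
      dep := Function.update c.dep c.num (x.dep + 1)
      par := Function.update c.par c.num (some (i, x.slot))
      lev := x.lev
      moves := c.moves + 1
      ok := true }

/-- Record the decisions of the current cluster and of the cluster with the root here. -/
def decided (c : Core d) (h p : ℕ) (ok rootOk : Bool) : Core d :=
  { c with
    ok := ok
    rootOk := rootOk
    tokens := if rootOk then c.tokens + p else c.tokens - h * p }

/-- The end of a step: `p` is the number of proposals to the cluster with the root here. -/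
noncomputable def settle (c : Core d) (h p : ℕ) (nb : Fin d → Info) (target : Option (Fin d))
    (ok rootOk : Bool) (nbOk : Fin d → Bool) : Core d :=
  match target with
  | none => c.decided h p ok rootOk
  | some i =>
    if nbOk i then (c.decided h p ok rootOk).join i (nb i)
    -- A removed node keeps its tree data, so it still relays messages.
    else { c.decided h p ok rootOk with alive := false }

/-- The end of a phase: clusters that rejected proposals enter the next level. -/
def raise (c : Core d) : Core d :=
  { c with
    lev := if c.ok then c.lev else c.lev + 1
    rootLev := if c.rootOk then c.rootLev else c.rootLev + 1 }

end Core

/-- `i` is the port of a living neighbour of least key. -/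
def IsTarget {d : ℕ} (x : Info) (nb : Fin d → Info) (i : Fin d) : Prop :=
  x.alive ∧ (nb i).alive ∧ (nb i).key < x.key ∧ ∀ j, (nb j).alive → (nb i).key ≤ (nb j).key

open Classical in
/-- The port of the neighbour to whose cluster a node proposes. -/
noncomputable def chooseTarget {d : ℕ} (x : Info) (nb : Fin d → Info) : Option (Fin d) :=
  if h : ∃ i, IsTarget x nb i then some h.choose else none

theorem isTarget_of_chooseTarget {d : ℕ} {x : Info} {nb : Fin d → Info} {i : Fin d}
    (h : chooseTarget x nb = some i) : IsTarget x nb i := by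
  unfold chooseTarget at h
  split_ifs at h with h'
  rw [← Option.some.inj h]
  exact h'.choose_spec

theorem key_le_of_chooseTarget_eq_none {d : ℕ} {x : Info} {nb : Fin d → Info}
    (h : chooseTarget x nb = none) (hx : x.alive) (i : Fin d) (hi : (nb i).alive) :
    x.key ≤ (nb i).key := by
  classical
  unfold chooseTarget at h
  split_ifs at h with h'
  by_contra! hlt
  obtain ⟨j, hj, hmin⟩ := Finset.exists_min_image
    (Finset.univ.filter fun j => (nb j).alive = true) (fun j => (nb j).key) ⟨i, by simpa using hi⟩
  simp only [Finset.mem_filter, Finset.mem_univ, true_and] at hj hmin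
  exact h' ⟨j, hx, hj, (hmin i hi).trans_lt hlt, hmin⟩

section

variable {V : Type*} {G : SimpleGraph V} {P : PortNumbering G}

/-- The data of the neighbours. -/
def nbInfo (C : ∀ v, Core (P.deg v)) (v : V) (i : Fin (P.deg v)) : Info := (C (P.nbr v i)).info

/-- The port of the neighbour to whose cluster `v` proposes, if any. -/
noncomputable def target (C : ∀ v, Core (P.deg v)) (v : V) : Option (Fin (P.deg v)) :=
  chooseTarget (C v).info (nbInfo C v)

variable [Fintype V]

open Classical in
/-- The nodes that propose to the cluster labelled `ℓ`. -/
noncomputable def proposers (C : ∀ v, Core (P.deg v)) (ℓ : ℕ) : Finset V :=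
  Finset.univ.filter fun v => ∃ i, target C v = some i ∧ (nbInfo C v i).lab = ℓ

/-- The cluster labelled `ℓ` accepts the proposals. -/
def Accepts (h : ℕ) (C : ∀ v, Core (P.deg v)) (ℓ : ℕ) : Prop :=
  -- Acceptance multiplies the tokens by at least `1 + 1 / (2h)`; rejection at price `h` per
  -- proposer costs less than half of them.
  ∃ r, (C r).ident = ℓ ∧ (C r).tokens ≤ 2 * h * (proposers C ℓ).card

open Classical in
/-- A step of the ball carving, as seen from outside. -/
noncomputable def bigStep (h : ℕ) (C : ∀ v, Core (P.deg v)) : ∀ v, Core (P.deg v) := fun v =>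
  (C v).settle h (proposers C (C v).ident).card (nbInfo C v) (target C v)
    (decide (Accepts h C ((C v).lab (C v).cur))) (decide (Accepts h C (C v).ident))
    fun i => decide (Accepts h C (nbInfo C v i).lab)

end

/-! ### Implementation of a step by message passing. -/

/-- The state of a node: besides its `Core`, what it knows about its neighbours, the neighbour to
which it proposes, the data of the bit-serial additions in its trees, the count of the proposals to
the cluster with the root here, and the decisions that are broadcast in its trees. -/
structure Node (d : ℕ) where
  core : Core d
  nb : Fin d → Info
  target : Option (Fin d)
  carry : ℕ → ℕ
  out : ℕ → Bool
  count : ℕ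
  dn : ℕ → Bool

/-- The parameters of the algorithm: a bound `D` on the depth of the trees, the number `U` of
rounds for an addition, a bound `M` on the number of trees of a node, the number `W` of bits for
each part of an `Info`, and the price `h` in tokens for the removal of a node. -/
structure Params where
  D : ℕ
  U : ℕ
  M : ℕ
  W : ℕ
  h : ℕ

namespace Params

variable (p : Params)

/-- The number of bits in a message. -/
def width : ℕ := 4 * p.W + 1 + p.M

/-- The nodes tell their neighbours about themselves, and choose to whom to propose. -/
noncomputable def announce : Round p.width Node where
  Msg := Bool × Fin (2 ^ p.W) × Fin (2 ^ p.W) × Fin (2 ^ p.W) × Fin (2 ^ p.W)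
  card_le := by
    simp only [Fintype.card_prod, Fintype.card_bool, Fintype.card_fin, width]
    calc 2 * (2 ^ p.W * (2 ^ p.W * (2 ^ p.W * 2 ^ p.W))) = 2 ^ (4 * p.W + 1) := by ring
      _ ≤ _ := Nat.pow_le_pow_right two_pos (by omega)
  send _ s _ := (s.core.alive, Fin.ofNat _ s.core.info.lab, Fin.ofNat _ s.core.info.lev,
    Fin.ofNat _ s.core.info.slot, Fin.ofNat _ s.core.info.dep)
  step _ s m :=
    let nb := fun i => ⟨(m i).1, (m i).2.1, (m i).2.2.1, (m i).2.2.2.1, (m i).2.2.2.2⟩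
    { s with nb := nb, target := chooseTarget s.core.info nb }

/-- The nodes propose, and prepare the count of the proposals. -/
def propose : Round p.width Node where
  Msg := Bool
  card_le := by
    rw [Fintype.card_bool]
    exact Nat.le_self_pow (by simp [width]) 2
  send _ s i := decide (s.target = some i)
  step _ s m :=
    { s with
      carry := fun j => if j = s.core.cur then
        (Finset.univ.filter fun i => m i = true).card * 2 ^ (p.D - s.core.dep j) else 0
      out := fun _ => false
      count := 0 }

/-- The bits that arrive for the tree number `q`. -/
def incoming {d M : ℕ} (m : Fin d → Fin M → Bool) (q : ℕ) : ℕ :=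
  if hq : q < M then (Finset.univ.filter fun i => m i ⟨q, hq⟩ = true).card else 0

theorem card_bits_le : Fintype.card (Fin p.M → Bool) ≤ 2 ^ p.width := by
  simpa [width] using Nat.pow_le_pow_right two_pos (by omega)

open Classical in
/-- A round of the bit-serial additions in all trees. -/
noncomputable def upcast (t : ℕ) : Round p.width Node where
  Msg := Fin p.M → Bool
  card_le := p.card_bits_le
  -- The position of the bit is the number of the tree at the receiving parent, so the bits of
  -- different trees do not collide.
  send _ s i q := decide (∃ j, s.core.par j = some (i, q.1) ∧ s.out j = true)
  step _ s m :=
    { s with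
      carry := fun q => (s.carry q + incoming m q) / 2
      out := fun q => decide ((s.carry q + incoming m q) % 2 = 1)
      -- Number 0 is always the tree rooted at the node itself.
      count := s.count + (s.carry 0 + incoming m 0) % 2 * 2 ^ t }

/-- The roots decide. -/
def conclude : Round p.width Node where
  Msg := Unit
  card_le := by simpa using Nat.one_le_two_pow
  send _ _ _ := ()
  step _ s _ :=
    { s with
      count := s.count / 2 ^ p.D
      -- Only entry 0 is meaningful yet; the entries of trees with a parent are overwritten by the
      -- broadcast.
      dn := fun _ => decide (s.core.tokens ≤ 2 * p.h * (s.count / 2 ^ p.D)) }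

/-- A round of the broadcast of the decisions in all trees. -/
def downcast : Round p.width Node where
  Msg := Fin p.M → Bool
  card_le := p.card_bits_le
  send _ s _ q := s.dn q
  step _ s m :=
    { s with
      dn := fun j => match s.core.par j with
        | none => s.dn j
        | some (i, q) => if hq : q < p.M then m i ⟨q, hq⟩ else false }

/-- The members of the clusters pass the decisions to the nodes that proposed to them. -/
noncomputable def settle : Round p.width Node where
  Msg := Bool
  card_le := p.propose.card_le
  send _ s _ := s.dn s.core.cur
  step _ s m :=
    { s with
      core := s.core.settle p.h s.count s.nb s.target (s.dn s.core.cur) (s.dn 0) m }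

/-- The levels are raised at the end of a phase. -/
def raise : Round p.width Node where
  Msg := Unit
  card_le := p.conclude.card_le
  send _ _ _ := ()
  step _ s _ := { s with core := s.core.raise }

/-- The rounds of one step. -/
noncomputable def stepRounds : List (Round p.width Node) :=
  p.announce :: p.propose :: ((List.range p.U).map p.upcast ++
    p.conclude :: (List.replicate p.D p.downcast ++ [p.settle]))

end Params

/-! ### The implementation computes `bigStep`. -/

section

variable {V : Type*} {G : SimpleGraph V} {P : PortNumbering G}

/-- The trees are consistent, and of depth at most `t`. -/
structure WellFormed (ident : V → ℕ) (C : ∀ v, Core (P.deg v)) (t : ℕ) : Prop where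
  ident_eq : ∀ v, (C v).ident = ident v
  cur_lt : ∀ v, (C v).cur < (C v).num
  lab_zero : ∀ v, (C v).lab 0 = ident v
  dep_zero : ∀ v, (C v).dep 0 = 0
  par_zero : ∀ v, (C v).par 0 = none
  par_of_le : ∀ v j, (C v).num ≤ j → (C v).par j = none
  par_of_lt : ∀ v j, 0 < j → j < (C v).num → ∃ i q, (C v).par j = some (i, q) ∧
    q < (C (P.nbr v i)).num ∧ (C (P.nbr v i)).lab q = (C v).lab j ∧
    (C v).dep j = (C (P.nbr v i)).dep q + 1
  lab_inj : ∀ v j j', j < (C v).num → j' < (C v).num → (C v).lab j = (C v).lab j' → j = j'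
  exists_root : ∀ v j, j < (C v).num → ∃ r, ident r = (C v).lab j
  dep_le : ∀ v j, j < (C v).num → (C v).dep j ≤ t

theorem WellFormed.num_pos {ident : V → ℕ} {C : ∀ v, Core (P.deg v)} {t : ℕ}
    (hC : WellFormed ident C t) (v : V) : 0 < (C v).num := (hC.cur_lt v).pos

/-- A parent pointer leads to a node of the same tree, one level higher. -/
theorem WellFormed.of_par {ident : V → ℕ} {C : ∀ v, Core (P.deg v)} {t : ℕ}
    (hC : WellFormed ident C t) {v : V} {j : ℕ} {i : Fin (P.deg v)} {q : ℕ}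
    (h : (C v).par j = some (i, q)) : 0 < j ∧ j < (C v).num ∧
    q < (C (P.nbr v i)).num ∧ (C (P.nbr v i)).lab q = (C v).lab j ∧
    (C v).dep j = (C (P.nbr v i)).dep q + 1 := by
  have h0 : 0 < j := by
    rcases Nat.eq_zero_or_pos j with rfl | h0
    · rw [hC.par_zero] at h; cases h
    · exact h0
  have h1 : j < (C v).num := by
    by_contra! h1
    rw [hC.par_of_le v j h1] at h; cases h
  obtain ⟨i', q', h', hq⟩ := hC.par_of_lt v j h0 h1
  rw [h] at h'
  cases h'
  exact ⟨h0, h1, hq⟩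

-- Each proposal is received by exactly one member of the cluster, so local counts can be added up
-- along the tree.
open Classical in
theorem sum_card_proposing [Fintype V] (C : ∀ v, Core (P.deg v)) (ℓ : ℕ) :
    (∑ w : V, if (C w).lab (C w).cur = ℓ then (Finset.univ.filter fun i =>
      target C (P.nbr w i) = some (P.back w i)).card else 0) = (proposers C ℓ).card := by
  have h0 : ∀ w, (Finset.univ.filter fun i => target C (P.nbr w i) = some (P.back w i)).card =
      ∑ v, if ∃ i, target C v = some i ∧ P.nbr v i = w then 1 else 0 := by
    intro w
    rw [← Finset.card_filter]
    convert P.card_ports w fun v i => target C v = some i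
  simp only [h0]
  have h : ∀ (c : Prop) [Decidable c] (f : V → ℕ),
      (if c then ∑ v, f v else 0) = ∑ v, if c then f v else 0 := by
    intro c _ f
    split_ifs <;> simp
  simp_rw [h]
  rw [Finset.sum_comm, proposers, Finset.card_filter]
  refine Finset.sum_congr rfl fun v _ => ?_
  cases hv : target C v with
  | none => simp
  | some i =>
    rw [Finset.sum_eq_single_of_mem (P.nbr v i) (Finset.mem_univ _)]
    · simp [nbInfo, Core.info]
    · intro w _ hw
      simp [Ne.symm hw]

variable {p : Params}

theorem execList_upcast_succ (t : ℕ) (σ : ∀ v, Node (P.deg v)) :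
    Round.execList ((List.range (t + 1)).map p.upcast) P σ =
      (p.upcast t).exec P (Round.execList ((List.range t).map p.upcast) P σ) := by
  rw [List.range_succ, List.map_append, Round.execList_append]
  rfl

theorem execList_upcast (t : ℕ) (σ : ∀ v, Node (P.deg v)) (v : V) :
    (Round.execList ((List.range t).map p.upcast) P σ v).core = (σ v).core ∧
    (Round.execList ((List.range t).map p.upcast) P σ v).nb = (σ v).nb ∧
    (Round.execList ((List.range t).map p.upcast) P σ v).target = (σ v).target := by
  induction t with
  | zero => exact ⟨rfl, rfl, rfl⟩
  | succ t ih =>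
    rw [execList_upcast_succ]
    exact ih

open Classical in
/-- The bits that arrive at `x` for its tree number `q` are those of its children there. -/
theorem incoming_upcast [Fintype V] {ident : V → ℕ} {C : ∀ v, Core (P.deg v)} {t M : ℕ}
    (hC : WellFormed ident C t) (out : V → ℕ → Bool) (ℓ : ℕ) (slot : V → ℕ)
    (hslot : ∀ v j, j < (C v).num → (C v).lab j = ℓ → slot v = j) (x : V)
    (hx : slot x < (C x).num) (hxl : (C x).lab (slot x) = ℓ) (hM : (C x).num ≤ M) :
    Params.incoming (M := M) (fun i q => decide (∃ j,
      (C (P.nbr x i)).par j = some (P.back x i, q.1) ∧ out (P.nbr x i) j = true)) (slot x) =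
    ∑ y ∈ Finset.univ.filter (fun v => ∃ j < (C v).num, (C v).lab j = ℓ),
      if (∃ i, (C y).par (slot y) = some (i, slot x) ∧ P.nbr y i = x) then
        (out y (slot y)).toNat else 0 := by
  have h1 : slot x < M := hx.trans_le hM
  rw [Params.incoming, dif_pos h1]
  simp only [decide_eq_true_eq]
  rw [P.card_ports x fun u i => ∃ j, (C u).par j = some (i, slot x) ∧ out u j = true,
    Finset.card_filter, Finset.sum_filter]
  refine Finset.sum_congr rfl fun y _ => ?_
  have hiff : (∃ i, (∃ j, (C y).par j = some (i, slot x) ∧ out y j = true) ∧ P.nbr y i = x) ↔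
      (∃ j < (C y).num, (C y).lab j = ℓ) ∧
      (∃ i, (C y).par (slot y) = some (i, slot x) ∧ P.nbr y i = x) ∧
        out y (slot y) = true := by
    constructor
    · rintro ⟨i, ⟨j, hj, ho⟩, hi⟩
      obtain ⟨-, hlt, -, hl, -⟩ := hC.of_par hj
      have hjl : (C y).lab j = ℓ := by rw [← hl, hi, hxl]
      rw [hslot y j hlt hjl]
      exact ⟨⟨j, hlt, hjl⟩, ⟨i, hj, hi⟩, ho⟩
    · rintro ⟨-, ⟨i, hj, hi⟩, ho⟩
      exact ⟨i, ⟨_, hj, ho⟩, hi⟩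
  rw [if_congr hiff rfl rfl]
  cases out y (slot y) <;> simp [ite_and]

open Classical in
/-- The root of a tree learns the number of the proposals to its cluster. -/
theorem count_upcast [Fintype V] {ident : V → ℕ} (σ : ∀ v, Node (P.deg v)) {t : ℕ}
    (hC : WellFormed ident (fun v => (σ v).core) t) (hinj : Function.Injective ident)
    (ht : t ≤ p.D) (hM : ∀ v, (σ v).core.num ≤ p.M) (hU : 2 ^ p.D * Fintype.card V < 2 ^ p.U)
    (hcarry : ∀ v j, (σ v).carry j = if j = (σ v).core.cur then (Finset.univ.filter fun i =>
      target (fun v => (σ v).core) (P.nbr v i) = some (P.back v i)).card *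
        2 ^ (p.D - (σ v).core.dep j) else 0)
    (hout : ∀ v j, (σ v).out j = false) (hcount : ∀ v, (σ v).count = 0) (r : V) :
    (Round.execList ((List.range p.U).map p.upcast) P σ r).count =
      2 ^ p.D * (proposers (fun v => (σ v).core) (ident r)).card := by
  set C : ∀ v, Core (P.deg v) := fun v => (σ v).core with hCdef
  set ℓ := ident r with hℓ
  -- The number of the tree labelled `ℓ` at `v`; the value 0 outside the tree is a dummy.
  let slot : V → ℕ := fun v => if h : ∃ j, j < (C v).num ∧ (C v).lab j = ℓ then Nat.find h else 0
  have hslot : ∀ v j, j < (C v).num → (C v).lab j = ℓ → slot v = j := by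
    intro v j hj hl
    have h : ∃ j, j < (C v).num ∧ (C v).lab j = ℓ := ⟨j, hj, hl⟩
    have hs := Nat.find_spec h
    simp only [slot, dif_pos h]
    exact hC.lab_inj v _ _ hs.1 hj (hs.2.trans hl.symm)
  let A : Finset V := Finset.univ.filter fun v => ∃ j < (C v).num, (C v).lab j = ℓ
  have hA : ∀ v, v ∈ A → slot v < (C v).num ∧ (C v).lab (slot v) = ℓ := by
    intro v hv
    obtain ⟨j, hj, hl⟩ := (Finset.mem_filter.1 hv).2
    rw [hslot v j hj hl]
    exact ⟨hj, hl⟩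
  have hmem : ∀ v j, j < (C v).num → (C v).lab j = ℓ → v ∈ A := fun v j hj hl =>
    Finset.mem_filter.2 ⟨Finset.mem_univ _, j, hj, hl⟩
  have hr0 : slot r = 0 := hslot r 0 (hC.num_pos r) (hC.lab_zero r)
  have hpos : ∀ v ∈ A, v ≠ r → 0 < slot v := by
    intro v hv hne
    refine Nat.pos_of_ne_zero fun h0 => hne (hinj ?_)
    rw [← hC.lab_zero v, ← hℓ, ← (hA v hv).2, h0]
  let τ : ℕ → ∀ v, Node (P.deg v) := fun s => Round.execList ((List.range s).map p.upcast) P σ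
  have hτ : ∀ s v, (τ s v).core = C v := fun s v => (execList_upcast s σ v).1
  let X : V → ℕ := fun v => if (C v).lab (C v).cur = ℓ then
    (Finset.univ.filter fun i => target C (P.nbr v i) = some (P.back v i)).card else 0
  have hX : ∑ x ∈ A, X x = (proposers C ℓ).card := by
    rw [← sum_card_proposing, Finset.sum_subset (Finset.subset_univ A)]
    intro v _ hv
    exact if_neg fun hl => hv (hmem v _ (hC.cur_lt v) hl)
  rw [← hX]
  have hin : ∀ s, ∀ x ∈ A, Params.incoming (M := p.M) (fun i => (p.upcast s).send _
      (τ s (P.nbr x i)) (P.back x i)) (slot x) = ∑ y ∈ A,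
        if (∃ i, (C y).par (slot y) = some (i, slot x) ∧ P.nbr y i = x) then
          ((τ s y).out (slot y)).toNat else 0 := by
    intro s x hx
    rw [← incoming_upcast hC (fun v => (τ s v).out) ℓ slot hslot x (hA x hx).1 (hA x hx).2 (hM x)]
    simp only [Params.upcast, hτ]
  have hbit : ∀ n : ℕ, 2 * (n / 2) + (decide (n % 2 = 1)).toNat = n := by
    intro n
    rcases Nat.mod_two_eq_zero_or_one n with h | h <;> simp [h] <;> omega
  have hbit' : ∀ n : ℕ, n % 2 = (decide (n % 2 = 1)).toNat := by
    intro n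
    rcases Nat.mod_two_eq_zero_or_one n with h | h <;> simp [h]
  refine bitSerial_sum A (fun v => (C v).dep (slot v))
    (fun y x => ∃ i, (C y).par (slot y) = some (i, slot x) ∧ P.nbr y i = x) r p.D
    (hmem r 0 (hC.num_pos r) (hC.lab_zero r)) ?_ ?_ ?_ ?_ ?_ X
    (fun s v => (τ s v).carry (slot v)) (fun s v => ((τ s v).out (slot v)).toNat)
    (fun s => (τ s r).count) ?_ ?_ ?_ p.U ?_ ?_ ?_
  · simp only [hr0]
    exact hC.dep_zero r
  · exact fun x hx => (hC.dep_le x _ (hA x hx).1).trans ht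
  · rintro y - ⟨i, hi, -⟩
    rw [hr0, hC.par_zero] at hi
    cases hi
  · intro x hx hne
    obtain ⟨i, q, h1, h2, h3, -⟩ := hC.par_of_lt x _ (hpos x hx hne) (hA x hx).1
    have h3' : (C (P.nbr x i)).lab q = ℓ := h3.trans (hA x hx).2
    refine ⟨P.nbr x i, hmem _ q h2 h3', fun z hz => ⟨?_, ?_⟩⟩
    · rintro ⟨i', hi', rfl⟩
      have := h1.symm.trans hi'
      cases this
      rfl
    · rintro rfl
      refine ⟨i, ?_, rfl⟩
      rw [hslot _ q h2 h3']
      exact h1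
  · rintro x - y - ⟨i, hi, rfl⟩
    exact (hC.of_par hi).2.2.2.2
  · intro x hx
    change (σ x).carry (slot x) = _
    rw [hcarry]
    by_cases hl : (C x).lab (C x).cur = ℓ
    · rw [if_pos (hslot x _ (hC.cur_lt x) hl)]
      simp only [X, if_pos hl]
      rfl
    · simp only [X, if_neg hl, zero_mul]
      exact if_neg fun h => hl (by rw [← (hA x hx).2, h])
  · intro x _
    change ((σ x).out (slot x)).toNat = 0
    rw [hout]
    rfl
  · exact hcount r
  · intro s _ x hx
    have e' := hbit ((τ s x).carry (slot x) + Params.incoming (M := p.M) (fun i =>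
      (p.upcast s).send _ (τ s (P.nbr x i)) (P.back x i)) (slot x))
    simp only [τ, execList_upcast_succ]
    refine e'.trans (congrArg _ ((hin s x hx).trans (Finset.sum_congr rfl fun y _ => ?_)))
    exact if_congr Iff.rfl rfl rfl
  · intro s _
    simp only [τ, execList_upcast_succ, hr0]
    exact congrArg _ (congrArg (· * 2 ^ s) (hbit' _))
  · rw [hX]
    exact (Nat.mul_le_mul_left _ (Finset.card_le_univ _)).trans_lt hU

theorem execList_downcast (s : ℕ) (σ : ∀ v, Node (P.deg v)) (v : V) :
    (Round.execList (List.replicate s p.downcast) P σ v).core = (σ v).core ∧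
    (Round.execList (List.replicate s p.downcast) P σ v).nb = (σ v).nb ∧
    (Round.execList (List.replicate s p.downcast) P σ v).target = (σ v).target ∧
    (Round.execList (List.replicate s p.downcast) P σ v).count = (σ v).count := by
  induction s generalizing σ with
  | zero => exact ⟨rfl, rfl, rfl, rfl⟩
  | succ s ih =>
    rw [List.replicate_succ, Round.execList_cons]
    exact ih _

/-- The decision of the root of a tree reaches all its nodes. -/
theorem dn_downcast {ident : V → ℕ} (σ : ∀ v, Node (P.deg v)) {t : ℕ}
    (hC : WellFormed ident (fun v => (σ v).core) t) (hM : ∀ v, (σ v).core.num ≤ p.M)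
    (f : ℕ → Bool) (hf : ∀ v, (σ v).dn 0 = f (ident v)) (s : ℕ) (v : V) (j : ℕ)
    (hj : j < (σ v).core.num) (hs : (σ v).core.dep j ≤ s) :
    (Round.execList (List.replicate s p.downcast) P σ v).dn j = f ((σ v).core.lab j) := by
  induction s generalizing v j with
  | zero =>
    have hj0 : j = 0 := by
      by_contra h0
      obtain ⟨i, q, -, -, -, h⟩ := hC.par_of_lt v j (Nat.pos_of_ne_zero h0) hj
      omega
    subst hj0
    rw [hC.lab_zero]
    exact hf v
  | succ s ih =>
    rw [List.replicate_succ', Round.execList_append]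
    set τ := Round.execList (List.replicate s p.downcast) P σ with hτ
    have hcore : (τ v).core = (σ v).core := (execList_downcast s σ v).1
    simp only [Round.execList_cons, Round.execList_nil, Round.exec, Params.downcast, hcore]
    rcases Nat.eq_zero_or_pos j with rfl | h0
    · rw [hC.par_zero]
      exact ih v 0 hj ((hC.dep_zero v).trans_le (Nat.zero_le _))
    · obtain ⟨i, q, h1, h2, h3, h4⟩ := hC.par_of_lt v j h0 hj
      rw [h1]
      simp only [dif_pos (h2.trans_le (hM _))]
      rw [ih _ q h2 (by omega), h3]

/-- Transmission reduces numbers modulo `2 ^ W`; the bounds make this lossless. -/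
theorem nb_announce (σ : ∀ v, Node (P.deg v))
    (hlab : ∀ v, (σ v).core.info.lab < 2 ^ p.W) (hlev : ∀ v, (σ v).core.info.lev < 2 ^ p.W)
    (hslot : ∀ v, (σ v).core.info.slot < 2 ^ p.W) (hdep : ∀ v, (σ v).core.info.dep < 2 ^ p.W)
    (v : V) : (p.announce.exec P σ v).nb = nbInfo (fun v => (σ v).core) v := by
  funext i
  have : ∀ (a : Bool) (x : Info), x.alive = a → x.lab < 2 ^ p.W → x.lev < 2 ^ p.W →
      x.slot < 2 ^ p.W → x.dep < 2 ^ p.W →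
      (⟨a, (Fin.ofNat (2 ^ p.W) x.lab).1, (Fin.ofNat (2 ^ p.W) x.lev).1,
        (Fin.ofNat (2 ^ p.W) x.slot).1, (Fin.ofNat (2 ^ p.W) x.dep).1⟩ : Info) = x := by
    rintro a ⟨_, _, _, _, _⟩ rfl h1 h2 h3 h4
    simp only [Fin.ofNat, Nat.mod_eq_of_lt h1, Nat.mod_eq_of_lt h2, Nat.mod_eq_of_lt h3,
      Nat.mod_eq_of_lt h4]
  exact this _ (σ (P.nbr v i)).core.info rfl (hlab _) (hlev _) (hslot _) (hdep _)

/-- The rounds of a step carry out `bigStep`. -/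
theorem execList_stepRounds [Fintype V] {ident : V → ℕ} (σ : ∀ v, Node (P.deg v)) {t : ℕ}
    (hC : WellFormed ident (fun v => (σ v).core) t) (hinj : Function.Injective ident)
    (ht : t ≤ p.D) (hM : ∀ v, (σ v).core.num ≤ p.M) (hU : 2 ^ p.D * Fintype.card V < 2 ^ p.U)
    (hident : ∀ v, ident v < 2 ^ p.W) (hlev : ∀ v, (σ v).core.lev < 2 ^ p.W)
    (hMW : p.M ≤ 2 ^ p.W) (hDW : p.D < 2 ^ p.W) (v : V) :
    (Round.execList p.stepRounds P σ v).core = bigStep p.h (fun v => (σ v).core) v := by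
  classical
  set C : ∀ v, Core (P.deg v) := fun v => (σ v).core with hCdef
  have hnb := nb_announce (p := p) σ (fun v => by
      obtain ⟨r, hr⟩ := hC.exists_root v _ (hC.cur_lt v)
      exact (hr ▸ hident r : (C v).lab (C v).cur < 2 ^ p.W)) hlev
    (fun v => ((hC.cur_lt v).trans_le ((hM v).trans hMW) : (C v).cur < 2 ^ p.W))
    (fun v => ((hC.dep_le v _ (hC.cur_lt v)).trans ht).trans_lt hDW)
  set σ1 := p.announce.exec P σ with hσ1
  have htgt : ∀ v, (σ1 v).target = target C v := fun v =>
    congrArg (chooseTarget (C v).info) (hnb v)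
  set σ2 := p.propose.exec P σ1 with hσ2
  have hcount := count_upcast (p := p) σ2 (t := t) hC hinj ht hM hU (fun v j => by
      change (if j = (C v).cur then (Finset.univ.filter fun i =>
        decide ((σ1 (P.nbr v i)).target = some (P.back v i)) = true).card *
          2 ^ (p.D - (C v).dep j) else 0) = _
      simp only [htgt, decide_eq_true_eq]
      rfl) (fun _ _ => rfl) (fun _ => rfl)
  have h3 := fun v => execList_upcast (p := p) p.U σ2 v
  set σ3 := Round.execList ((List.range p.U).map p.upcast) P σ2 with hσ3
  set σ4 := p.conclude.exec P σ3 with hσ4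
  have hcore4 : ∀ v, (σ4 v).core = C v := fun v => (h3 v).1
  have hcount4 : ∀ v, (σ4 v).count = (proposers C (ident v)).card := by
    intro v
    change (σ3 v).count / 2 ^ p.D = _
    rw [hcount v, Nat.mul_div_cancel_left _ (by positivity)]
    rfl
  have hdn4 : ∀ v, (σ4 v).dn 0 = decide (Accepts p.h C (ident v)) := by
    intro v
    change decide ((σ3 v).core.tokens ≤ 2 * p.h * (σ4 v).count) = _
    rw [hcount4 v, (h3 v).1]
    refine decide_eq_decide.2 ⟨fun h => ⟨v, hC.ident_eq v, h⟩, ?_⟩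
    rintro ⟨r, hr, h⟩
    have : r = v := hinj ((hC.ident_eq r).symm.trans hr)
    subst this
    exact h
  have hC4 : WellFormed ident (fun v => (σ4 v).core) t := by
    simp only [hcore4]
    exact hC
  have hdn5 := dn_downcast (p := p) σ4 hC4 (fun v => by rw [hcore4]; exact hM v)
    (fun ℓ => decide (Accepts p.h C ℓ)) hdn4 p.D
  have h5 := fun v => execList_downcast (p := p) p.D σ4 v
  simp only [hcore4] at h5 hdn5
  have hrun : Round.execList p.stepRounds P σ =
      p.settle.exec P (Round.execList (List.replicate p.D p.downcast) P σ4) := by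
    simp only [Params.stepRounds, Round.execList_cons, Round.execList_append, Round.execList_nil,
      ← hσ1, ← hσ2, ← hσ3, ← hσ4]
  rw [hrun]
  set σ5 := Round.execList (List.replicate p.D p.downcast) P σ4 with hσ5
  have hcur : ∀ v, (σ5 v).dn (C v).cur = decide (Accepts p.h C ((C v).lab (C v).cur)) :=
    fun v => hdn5 v _ (hC.cur_lt v) ((hC.dep_le v _ (hC.cur_lt v)).trans ht)
  change (σ5 v).core.settle p.h (σ5 v).count (σ5 v).nb (σ5 v).target ((σ5 v).dn (σ5 v).core.cur)
    ((σ5 v).dn 0) (fun i => (σ5 (P.nbr v i)).dn (σ5 (P.nbr v i)).core.cur) = _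
  obtain ⟨e1, e2, e3, e4⟩ := h5 v
  have e2' : (σ5 v).nb = nbInfo C v := by
    rw [e2]
    exact (h3 v).2.1.trans (hnb v)
  have e3' : (σ5 v).target = target C v := by
    rw [e3]
    exact (h3 v).2.2.trans (htgt v)
  have e5 : (σ5 v).dn 0 = decide (Accepts p.h C (ident v)) := by
    rw [hdn5 v 0 (hC.num_pos v) ((hC.dep_zero v).trans_le (Nat.zero_le _)), hC.lab_zero]
  rw [e1, e2', e3', e4, hcount4, hcur, e5, bigStep, hC.ident_eq]
  congr 1
  funext i
  rw [(h5 _).1, hcur]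
  rfl

end

/-! ### The effect of a step on a single node, and the consistency of the trees. -/

namespace Core

variable {d : ℕ} (c : Core d) (i : Fin d) (x : Info)

theorem join_alive : (c.join i x).alive = c.alive := by unfold join; split_ifs <;> rfl
theorem join_ident : (c.join i x).ident = c.ident := by unfold join; split_ifs <;> rfl
theorem join_rootLev : (c.join i x).rootLev = c.rootLev := by unfold join; split_ifs <;> rfl
theorem join_tokens : (c.join i x).tokens = c.tokens := by unfold join; split_ifs <;> rfl
theorem join_rootOk : (c.join i x).rootOk = c.rootOk := by unfold join; split_ifs <;> rfl
theorem join_lev : (c.join i x).lev = x.lev := by unfold join; split_ifs <;> rfl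
theorem join_moves : (c.join i x).moves = c.moves + 1 := by unfold join; split_ifs <;> rfl
theorem join_ok : (c.join i x).ok = true := by unfold join; split_ifs <;> rfl

theorem join_num_le : (c.join i x).num ≤ c.num + 1 := by
  unfold join; split_ifs <;> simp

theorem le_join_num : c.num ≤ (c.join i x).num := by
  unfold join; split_ifs <;> simp

theorem join_cur_lt : (c.join i x).cur < (c.join i x).num := by
  classical
  unfold join
  split_ifs with h
  · exact (Nat.find_spec h).1
  · exact Nat.lt_succ_self _

theorem join_lab_cur : (c.join i x).lab (c.join i x).cur = x.lab := by
  classical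
  unfold join
  split_ifs with h
  · exact (Nat.find_spec h).2
  · exact Function.update_self ..

theorem join_of_lt {j : ℕ} (hj : j < c.num) : (c.join i x).lab j = c.lab j ∧
    (c.join i x).dep j = c.dep j ∧ (c.join i x).par j = c.par j := by
  unfold join
  split_ifs
  · exact ⟨rfl, rfl, rfl⟩
  · exact ⟨Function.update_of_ne hj.ne .., Function.update_of_ne hj.ne ..,
      Function.update_of_ne hj.ne ..⟩

theorem join_of_le {j : ℕ} (hj : c.num ≤ j) (hj' : j < (c.join i x).num) :
    j = c.num ∧ (c.join i x).lab j = x.lab ∧ (c.join i x).dep j = x.dep + 1 ∧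
      (c.join i x).par j = some (i, x.slot) ∧ ∀ j' < c.num, c.lab j' ≠ x.lab := by
  unfold join at hj' ⊢
  split_ifs at hj' ⊢ with h
  · exact absurd hj' hj.not_gt
  · obtain rfl : j = c.num := by
      have : j < c.num + 1 := hj'
      omega
    push Not at h
    exact ⟨rfl, Function.update_self .., Function.update_self .., Function.update_self .., h⟩

theorem join_par_of_le (hc : ∀ j, c.num ≤ j → c.par j = none) {j : ℕ}
    (hj : (c.join i x).num ≤ j) : (c.join i x).par j = none := by
  unfold join at hj ⊢
  split_ifs at hj ⊢
  · exact hc j hj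
  · have : c.num + 1 ≤ j := hj
    exact (Function.update_of_ne (by omega) ..).trans (hc j (by omega))

end Core

section

variable {V : Type*} {G : SimpleGraph V} {P : PortNumbering G}
  {ident : V → ℕ} {C : ∀ v, Core (P.deg v)} {t h : ℕ}

/-- The label of the current cluster. -/
abbrev curLab (C : ∀ v, Core (P.deg v)) (v : V) : ℕ := (C v).lab (C v).cur

theorem WellFormed.raise (hC : WellFormed ident C t) :
    WellFormed ident (fun v => (C v).raise) t :=
  ⟨hC.1, hC.2, hC.3, hC.4, hC.5, hC.6, hC.7, hC.8, hC.9, hC.10⟩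

variable [Fintype V]

open Classical in
theorem bigStep_cases (h : ℕ) (C : ∀ v, Core (P.deg v)) (v : V) :
    ∃ c, c = (C v).decided h (proposers C (C v).ident).card
      (decide (Accepts h C (curLab C v))) (decide (Accepts h C (C v).ident)) ∧
    ((target C v = none ∧ bigStep h C v = c) ∨
    (∃ i, target C v = some i ∧ Accepts h C (curLab C (P.nbr v i)) ∧
      bigStep h C v = c.join i (nbInfo C v i)) ∨
    (∃ i, target C v = some i ∧ ¬ Accepts h C (curLab C (P.nbr v i)) ∧
      bigStep h C v = { c with alive := false })) := by
  refine ⟨_, rfl, ?_⟩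
  unfold bigStep Core.settle
  cases hv : target C v with
  | none => exact Or.inl ⟨rfl, rfl⟩
  | some i =>
    by_cases ha : Accepts h C (curLab C (P.nbr v i))
    · exact Or.inr (Or.inl ⟨i, rfl, ha, by
        simp only
        exact if_pos (decide_eq_true ha)⟩)
    · exact Or.inr (Or.inr ⟨i, rfl, ha, by
        simp only
        exact if_neg fun hd => ha (of_decide_eq_true hd)⟩)

/-- A step only appends to the list of trees of a node. -/
theorem bigStep_of_lt (v : V) : (C v).num ≤ (bigStep h C v).num ∧ ∀ j < (C v).num,
    (bigStep h C v).lab j = (C v).lab j ∧ (bigStep h C v).dep j = (C v).dep j ∧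
    (bigStep h C v).par j = (C v).par j := by
  obtain ⟨c, hc, ⟨-, e⟩ | ⟨i, -, -, e⟩ | ⟨i, -, -, e⟩⟩ := bigStep_cases h C v <;> rw [e]
  · subst hc
    exact ⟨le_rfl, fun _ _ => ⟨rfl, rfl, rfl⟩⟩
  · have h1 := c.le_join_num i (nbInfo C v i)
    have h2 := fun j => c.join_of_lt i (nbInfo C v i) (j := j)
    rw [hc] at h1 h2 ⊢
    exact ⟨h1, h2⟩
  · subst hc
    exact ⟨le_rfl, fun _ _ => ⟨rfl, rfl, rfl⟩⟩

theorem bigStep_of_le (v : V) {j : ℕ} (hj : (C v).num ≤ j) (hj' : j < (bigStep h C v).num) :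
    j = (C v).num ∧ ∃ i, (bigStep h C v).par j = some (i, (C (P.nbr v i)).cur) ∧
      (bigStep h C v).lab j = curLab C (P.nbr v i) ∧
      (bigStep h C v).dep j = (C (P.nbr v i)).dep (C (P.nbr v i)).cur + 1 ∧
      ∀ j' < (C v).num, (C v).lab j' ≠ curLab C (P.nbr v i) := by
  obtain ⟨c, hc, ⟨-, e⟩ | ⟨i, -, -, e⟩ | ⟨i, -, -, e⟩⟩ := bigStep_cases h C v <;> rw [e] at hj' ⊢
  · subst hc
    exact absurd hj' hj.not_gt
  · have h1 := fun hj => c.join_of_le i (nbInfo C v i) (j := j) hj hj'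
    rw [hc] at h1 ⊢
    obtain ⟨h2, h3, h4, h5, h6⟩ := h1 hj
    exact ⟨h2, i, h5, h3, h4, h6⟩
  · subst hc
    exact absurd hj' hj.not_gt

theorem bigStep_ident (v : V) : (bigStep h C v).ident = (C v).ident := by
  obtain ⟨c, rfl, ⟨-, e⟩ | ⟨i, -, -, e⟩ | ⟨i, -, -, e⟩⟩ := bigStep_cases h C v <;> rw [e]
  · rfl
  · rw [Core.join_ident]; rfl
  · rfl

theorem bigStep_rootLev (v : V) : (bigStep h C v).rootLev = (C v).rootLev := by
  obtain ⟨c, rfl, ⟨-, e⟩ | ⟨i, -, -, e⟩ | ⟨i, -, -, e⟩⟩ := bigStep_cases h C v <;> rw [e]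
  · rfl
  · rw [Core.join_rootLev]; rfl
  · rfl

open Classical in
theorem bigStep_tokens (v : V) : (bigStep h C v).tokens = if Accepts h C (C v).ident then
    (C v).tokens + (proposers C (C v).ident).card else
    (C v).tokens - h * (proposers C (C v).ident).card := by
  obtain ⟨c, rfl, ⟨-, e⟩ | ⟨i, -, -, e⟩ | ⟨i, -, -, e⟩⟩ := bigStep_cases h C v <;> rw [e]
  · simp [Core.decided]
  · rw [Core.join_tokens]; simp [Core.decided]
  · simp [Core.decided]

open Classical in
theorem bigStep_rootOk (v : V) :
    (bigStep h C v).rootOk = decide (Accepts h C (C v).ident) := by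
  obtain ⟨c, rfl, ⟨-, e⟩ | ⟨i, -, -, e⟩ | ⟨i, -, -, e⟩⟩ := bigStep_cases h C v <;> rw [e]
  · rfl
  · rw [Core.join_rootOk]; rfl
  · rfl

/-- What a step does to the nodes that survive it. -/
theorem bigStep_of_alive {v : V} (hv : (bigStep h C v).alive) : (C v).alive ∧
    ((target C v = none ∧ curLab (bigStep h C) v = curLab C v ∧
      (bigStep h C v).lev = (C v).lev ∧ (bigStep h C v).moves = (C v).moves) ∨
    ∃ i, target C v = some i ∧ Accepts h C (curLab C (P.nbr v i)) ∧
      curLab (bigStep h C) v = curLab C (P.nbr v i) ∧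
      (bigStep h C v).lev = (C (P.nbr v i)).lev ∧
      (bigStep h C v).moves = (C v).moves + 1) := by
  classical
  obtain ⟨c, rfl, ⟨ht, e⟩ | ⟨i, ht, ha, e⟩ | ⟨i, -, -, e⟩⟩ := bigStep_cases h C v
  · rw [e] at hv
    refine ⟨hv, Or.inl ⟨ht, ?_⟩⟩
    rw [curLab, e]
    exact ⟨rfl, rfl, rfl⟩
  · rw [e, Core.join_alive] at hv
    refine ⟨hv, Or.inr ⟨i, ht, ha, ?_⟩⟩
    rw [curLab, e, Core.join_lab_cur, Core.join_lev, Core.join_moves]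
    exact ⟨rfl, rfl, rfl⟩
  · rw [e] at hv
    cases hv

-- The flag refers to the cluster after the step: a node that joins replaces the decision of its old
-- cluster by the acceptance it has just received.
open Classical in
theorem bigStep_ok {v : V} (hv : (bigStep h C v).alive) :
    (bigStep h C v).ok = decide (Accepts h C (curLab (bigStep h C) v)) := by
  obtain ⟨c, rfl, ⟨ht, e⟩ | ⟨i, ht, ha, e⟩ | ⟨i, -, -, e⟩⟩ := bigStep_cases h C v
  · rw [curLab, e]
    rfl
  · rw [curLab, e, Core.join_ok, Core.join_lab_cur]
    exact (decide_eq_true ha).symm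
  · rw [e] at hv
    cases hv

/-- The nodes that join another cluster. -/
def Joins (h : ℕ) (C : ∀ v, Core (P.deg v)) (v : V) : Prop :=
  ∃ i, target C v = some i ∧ Accepts h C (curLab C (P.nbr v i))

/-- The nodes that are removed. -/
def Dies (h : ℕ) (C : ∀ v, Core (P.deg v)) (v : V) : Prop :=
  ∃ i, target C v = some i ∧ ¬ Accepts h C (curLab C (P.nbr v i))

open Classical in
theorem bigStep_moves (v : V) :
    (bigStep h C v).moves = (C v).moves + if Joins h C v then 1 else 0 := by
  obtain ⟨c, rfl, ⟨ht, e⟩ | ⟨i, ht, ha, e⟩ | ⟨i, ht, ha, e⟩⟩ := bigStep_cases h C v <;> rw [e]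
  · rw [if_neg (by simp [Joins, ht])]; rfl
  · rw [if_pos ⟨i, ht, ha⟩, Core.join_moves]; rfl
  · rw [if_neg (by simp [Joins, ht, ha])]; rfl

theorem bigStep_alive_iff (v : V) : (bigStep h C v).alive ↔ (C v).alive ∧ ¬ Dies h C v := by
  obtain ⟨c, rfl, ⟨ht, e⟩ | ⟨i, ht, ha, e⟩ | ⟨i, ht, ha, e⟩⟩ := bigStep_cases h C v <;> rw [e]
  · simp [Dies, ht, Core.decided]
  · rw [Core.join_alive]
    simp [Dies, ht, ha, Core.decided]
  · simp [Dies, ht, ha]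

theorem bigStep_num_le (v : V) (hv : (C v).num ≤ (C v).moves + 1) :
    (bigStep h C v).num ≤ (bigStep h C v).moves + 1 := by
  obtain ⟨c, hc, ⟨-, e⟩ | ⟨i, -, -, e⟩ | ⟨i, -, -, e⟩⟩ := bigStep_cases h C v <;> rw [e]
  · subst hc
    exact hv
  · have := c.join_num_le i (nbInfo C v i)
    rw [Core.join_moves]
    have h2 : c.num ≤ c.moves + 1 := by subst hc; exact hv
    omega
  · subst hc
    exact hv

theorem bigStep_cur_lt (v : V) (hv : (C v).cur < (C v).num) :
    (bigStep h C v).cur < (bigStep h C v).num := by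
  obtain ⟨c, rfl, ⟨-, e⟩ | ⟨i, -, -, e⟩ | ⟨i, -, -, e⟩⟩ := bigStep_cases h C v <;> rw [e]
  · exact hv
  · exact Core.join_cur_lt ..
  · exact hv

theorem bigStep_par_of_le (v : V) (hv : ∀ j, (C v).num ≤ j → (C v).par j = none) {j : ℕ}
    (hj : (bigStep h C v).num ≤ j) : (bigStep h C v).par j = none := by
  obtain ⟨c, hc, ⟨-, e⟩ | ⟨i, -, -, e⟩ | ⟨i, -, -, e⟩⟩ := bigStep_cases h C v <;> rw [e] at hj ⊢
  · subst hc
    exact hv j hj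
  · exact c.join_par_of_le i _ (by subst hc; exact hv) hj
  · subst hc
    exact hv j hj

theorem bigStep_lev_le (v : V) {l : ℕ} (hl : ∀ v, (C v).lev ≤ l) : (bigStep h C v).lev ≤ l := by
  obtain ⟨c, rfl, ⟨-, e⟩ | ⟨i, -, -, e⟩ | ⟨i, -, -, e⟩⟩ := bigStep_cases h C v <;> rw [e]
  · exact hl v
  · rw [Core.join_lev]
    exact hl _
  · exact hl v

/-- Existing tree entries never change, and a new one hangs below an entry present before the step,
so the depth bound grows by one. -/
theorem WellFormed.bigStep (hC : WellFormed ident C t) :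
    WellFormed ident (bigStep h C) (t + 1) where
  ident_eq v := (bigStep_ident v).trans (hC.ident_eq v)
  cur_lt v := bigStep_cur_lt v (hC.cur_lt v)
  lab_zero v := ((bigStep_of_lt v).2 0 (hC.num_pos v)).1.trans (hC.lab_zero v)
  dep_zero v := ((bigStep_of_lt v).2 0 (hC.num_pos v)).2.1.trans (hC.dep_zero v)
  par_zero v := ((bigStep_of_lt v).2 0 (hC.num_pos v)).2.2.trans (hC.par_zero v)
  par_of_le v _ hj := bigStep_par_of_le v (hC.par_of_le v) hj
  par_of_lt v j h0 hj := by
    rcases lt_or_ge j (C v).num with hlt | hge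
    · obtain ⟨e1, e2, e3⟩ := (bigStep_of_lt (h := h) v).2 j hlt
      obtain ⟨i, q, h1, h2, h3, h4⟩ := hC.par_of_lt v j h0 hlt
      obtain ⟨hn, hq⟩ := bigStep_of_lt (h := h) (C := C) (P.nbr v i)
      obtain ⟨f1, f2, -⟩ := hq q h2
      exact ⟨i, q, e3.trans h1, h2.trans_le hn, by rw [f1, h3, e1], by rw [e2, h4, f2]⟩
    · obtain ⟨-, i, h1, h2, h3, -⟩ := bigStep_of_le v hge hj
      obtain ⟨hn, hq⟩ := bigStep_of_lt (h := h) (C := C) (P.nbr v i)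
      obtain ⟨f1, f2, -⟩ := hq _ (hC.cur_lt _)
      exact ⟨i, _, h1, (hC.cur_lt _).trans_le hn, by rw [f1, h2], by rw [h3, f2]⟩
  lab_inj v j j' hj hj' e := by
    rcases lt_or_ge j (C v).num with hlt | hge <;> rcases lt_or_ge j' (C v).num with hlt' | hge'
    · rw [((bigStep_of_lt v).2 j hlt).1, ((bigStep_of_lt v).2 j' hlt').1] at e
      exact hC.lab_inj v j j' hlt hlt' e
    · obtain ⟨-, i, -, h2, -, h4⟩ := bigStep_of_le v hge' hj'
      rw [h2, ((bigStep_of_lt v).2 j hlt).1] at e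
      exact absurd e (h4 j hlt)
    · obtain ⟨-, i, -, h2, -, h4⟩ := bigStep_of_le v hge hj
      rw [h2, ((bigStep_of_lt v).2 j' hlt').1] at e
      exact absurd e.symm (h4 j' hlt')
    · rw [(bigStep_of_le v hge hj).1, (bigStep_of_le v hge' hj').1]
  exists_root v j hj := by
    rcases lt_or_ge j (C v).num with hlt | hge
    · rw [((bigStep_of_lt v).2 j hlt).1]
      exact hC.exists_root v j hlt
    · obtain ⟨-, i, -, h2, -⟩ := bigStep_of_le v hge hj
      rw [h2]
      exact hC.exists_root _ _ (hC.cur_lt _)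
  dep_le v j hj := by
    rcases lt_or_ge j (C v).num with hlt | hge
    · rw [((bigStep_of_lt v).2 j hlt).2.1]
      exact (hC.dep_le v j hlt).trans (Nat.le_succ t)
    · obtain ⟨-, i, -, -, h3, -⟩ := bigStep_of_le v hge hj
      rw [h3]
      exact Nat.succ_le_succ (hC.dep_le _ _ (hC.cur_lt _))

end

/-! ### Settled clusters and the invariants. -/

section

variable {V : Type*} {G : SimpleGraph V} {P : PortNumbering G}
  {ident : V → ℕ} {C : ∀ v, Core (P.deg v)} {t h : ℕ}

/-- The key of the current cluster. -/
abbrev curKey (C : ∀ v, Core (P.deg v)) (v : V) : ℕ := (C v).info.key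

theorem curKey_eq (C : ∀ v, Core (P.deg v)) (v : V) :
    curKey C v = 2 * (C v).lev + if (curLab C v).testBit (C v).lev then 0 else 1 := rfl

/-- No living neighbour of the cluster labelled `ℓ` wants to join it. -/
def Settled (C : ∀ v, Core (P.deg v)) (ℓ : ℕ) : Prop :=
  ∀ u w, (C u).alive → curLab C u = ℓ → G.Adj u w → (C w).alive → curKey C w ≤ curKey C u

theorem target_some {v : V} {i : Fin (P.deg v)} (hv : target C v = some i) :
    (C v).alive ∧ (C (P.nbr v i)).alive ∧ curKey C (P.nbr v i) < curKey C v ∧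
      ∀ w, G.Adj v w → (C w).alive → curKey C (P.nbr v i) ≤ curKey C w := by
  obtain ⟨h1, h2, h3, h4⟩ := isTarget_of_chooseTarget hv
  refine ⟨h1, h2, h3, fun w hw ha => ?_⟩
  obtain ⟨j, rfl⟩ := P.exists_nbr_eq hw
  exact h4 j ha

theorem target_none {v w : V} (hv : target C v = none) (ha : (C v).alive) (hw : G.Adj v w)
    (hwa : (C w).alive) : curKey C v ≤ curKey C w := by
  obtain ⟨j, rfl⟩ := P.exists_nbr_eq hw
  exact key_le_of_chooseTarget_eq_none hv ha j hwa

theorem lev_le_of_curKey_le {u w : V} (hk : curKey C u ≤ curKey C w) : (C u).lev ≤ (C w).lev := by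
  rw [curKey_eq, curKey_eq] at hk
  split_ifs at hk <;> omega

theorem modEq_two_pow_succ {a b l : ℕ} (h : a ≡ b [MOD 2 ^ l]) (hb : a.testBit l = b.testBit l) :
    a ≡ b [MOD 2 ^ (l + 1)] := by
  refine Nat.eq_of_testBit_eq fun i => ?_
  have hi := congrArg (Nat.testBit · i) h
  simp only [Nat.testBit_mod_two_pow] at hi ⊢
  rcases lt_trichotomy i l with hl | rfl | hl
  · simpa [hl, hl.trans (Nat.lt_succ_self l)] using hi
  · rw [hb]
  · simp [show ¬ i < l + 1 by omega]

variable [Fintype V]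

theorem curKey_bigStep {v : V} (hv : (bigStep h C v).alive) :
    (target C v = none ∧ curKey (bigStep h C) v = curKey C v) ∨
    ∃ i, target C v = some i ∧ curKey (bigStep h C) v = curKey C (P.nbr v i) := by
  obtain ⟨-, ⟨h1, h2, h3, -⟩ | ⟨i, h1, -, h2, h3, -⟩⟩ := bigStep_of_alive hv
  · refine Or.inl ⟨h1, ?_⟩
    rw [curKey_eq, h2, h3, curKey_eq]
  · refine Or.inr ⟨i, h1, ?_⟩
    rw [curKey_eq, h2, h3, curKey_eq]

theorem curKey_bigStep_le {v : V} (hv : (bigStep h C v).alive) :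
    curKey (bigStep h C) v ≤ curKey C v := by
  obtain ⟨-, e⟩ | ⟨i, hi, e⟩ := curKey_bigStep hv
  · exact e.le
  · exact e.trans_le (target_some hi).2.2.1.le

/-- A cluster that rejects is settled. -/
theorem settled_of_not_accepts {ℓ : ℕ} (hℓ : ¬ Accepts h C ℓ) : Settled (bigStep h C) ℓ := by
  intro u w hu hul huw hw
  obtain ⟨hua, ⟨h1, h2, h3, -⟩ | ⟨i, -, h2, h3, -⟩⟩ := bigStep_of_alive hu
  · have e : curKey (bigStep h C) u = curKey C u := by rw [curKey_eq, h2, h3, curKey_eq]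
    rw [e]
    obtain ⟨h4, e'⟩ | ⟨i, hi, e'⟩ := curKey_bigStep hw <;> rw [e']
    · exact target_none h4 (bigStep_of_alive hw).1 huw.symm hua
    · exact (target_some hi).2.2.2 u huw.symm hua
  · rw [← hul, h3] at hℓ
    exact absurd h2 hℓ

theorem Settled.proposers_eq_empty {ℓ : ℕ} (hs : Settled C ℓ) : proposers C ℓ = ∅ := by
  refine Finset.filter_eq_empty_iff.2 ?_
  rintro v - ⟨i, hi, hl⟩
  obtain ⟨h1, h2, h3, -⟩ := target_some hi
  exact h3.not_ge (hs _ _ h2 hl (P.adj_nbr v i).symm h1)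

/-- Nobody proposes to a settled cluster, so it gains no members, and the keys of surviving
neighbours only drop. -/
theorem Settled.bigStep {ℓ : ℕ} (hs : Settled C ℓ) : Settled (bigStep h C) ℓ := by
  intro u w hu hul huw hw
  obtain ⟨hua, ⟨h1, h2, h3, -⟩ | ⟨i, h1, -, h3, -⟩⟩ := bigStep_of_alive hu
  · have e : curKey (BallCarving.bigStep h C) u = curKey C u := by
      rw [curKey_eq, h2, h3, curKey_eq]
    rw [e]
    exact (curKey_bigStep_le hw).trans
      (hs u w hua (h2.symm.trans hul) huw (bigStep_of_alive hw).1)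
  · have : u ∈ proposers C ℓ :=
      Finset.mem_filter.2 ⟨Finset.mem_univ _, i, h1, h3.symm.trans hul⟩
    rw [hs.proposers_eq_empty] at this
    simp at this

/-- The invariants of the ball carving of `S` after `τ` complete phases. -/
structure Invariant (S : Finset V) (ident : V → ℕ) (h : ℕ) (C : ∀ v, Core (P.deg v)) (τ : ℕ) :
    Prop where
  mem_of_alive : ∀ v, (C v).alive → v ∈ S
  root_mem : ∀ v, (C v).alive → ∃ r ∈ S, ident r = curLab C v
  lev_eq : ∀ v r, (C v).alive → ident r = curLab C v → (C v).lev = (C r).rootLev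
  agree : ∀ u w, (C u).alive → (C w).alive → G.Adj u w →
    curLab C u ≡ curLab C w [MOD 2 ^ min (C u).lev (C w).lev]
  -- A potential: a move lowers the key by at least one, the end of a phase raises it by at most
  -- three.
  moves_add_le : ∀ v, (C v).alive → (C v).moves + curKey C v ≤ 3 * τ + 1
  moves_le : ∀ v, (C v).moves ≤ 3 * τ + 1
  moves_eq : ∀ v, v ∉ S → (C v).moves = 0
  num_le : ∀ v, (C v).num ≤ (C v).moves + 1
  lev_le : ∀ v, (C v).lev ≤ τ
  -- Conservation: every move creates one token, every removal destroys `h`.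
  tokens_eq : ∑ r, (C r).tokens + h * (S.filter fun v => (C v).alive = false).card =
    S.card + ∑ v, (C v).moves

theorem accepts_iff (hC : WellFormed ident C t) (hinj : Function.Injective ident) (r : V) :
    Accepts h C (ident r) ↔ (C r).tokens ≤ 2 * h * (proposers C (ident r)).card := by
  refine ⟨?_, fun h => ⟨r, hC.ident_eq r, h⟩⟩
  rintro ⟨r', hr', h'⟩
  obtain rfl : r' = r := hinj ((hC.ident_eq r').symm.trans hr')
  exact h'

open Classical in
theorem sum_card_proposers (hC : WellFormed ident C t) (hinj : Function.Injective ident)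
    (Q : ℕ → Prop) : (∑ r, if Q (ident r) then (proposers C (ident r)).card else 0) =
      (Finset.univ.filter fun v => ∃ i, target C v = some i ∧ Q (curLab C (P.nbr v i))).card := by
  have h0 : ∀ r, (if Q (ident r) then (proposers C (ident r)).card else 0) =
      ∑ v, if Q (ident r) ∧ v ∈ proposers C (ident r) then 1 else 0 := by
    intro r
    by_cases hr : Q (ident r) <;> simp [hr]
  simp only [h0]
  rw [Finset.sum_comm, Finset.card_filter]
  refine Finset.sum_congr rfl fun v _ => ?_
  cases hv : target C v with
  | none => simp [proposers, hv]
  | some i =>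
    obtain ⟨r, hr⟩ := hC.exists_root (P.nbr v i) _ (hC.cur_lt _)
    rw [Finset.sum_eq_single_of_mem r (Finset.mem_univ _)]
    · refine if_congr ?_ rfl rfl
      simp only [proposers, Finset.mem_filter, Finset.mem_univ, true_and, hv, Option.some.injEq,
        exists_eq_left', curLab, hr]
      simp [nbInfo, Core.info]
    · intro r' _ hne
      refine if_neg ?_
      rintro ⟨-, hm⟩
      simp only [proposers, Finset.mem_filter, Finset.mem_univ, true_and, hv, Option.some.injEq,
        exists_eq_left'] at hm
      exact hne (hinj (hm.symm.trans hr.symm))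

theorem tokens_bigStep {S : Finset V} {τ : ℕ} (hI : Invariant S ident h C τ)
    (hC : WellFormed ident C t) (hinj : Function.Injective ident) :
    ∑ r, (bigStep h C r).tokens + h * (S.filter fun v => (bigStep h C v).alive = false).card =
      S.card + ∑ v, (bigStep h C v).moves := by
  classical
  have hacc := sum_card_proposers hC hinj (Accepts h C)
  have hrej : (∑ r, if ¬ Accepts h C (ident r) then (proposers C (ident r)).card else 0) =
      (Finset.univ.filter fun v => ∃ i, target C v = some i ∧
        ¬ Accepts h C (curLab C (P.nbr v i))).card := by
    convert sum_card_proposers hC hinj fun ℓ => ¬ Accepts h C ℓ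
  have h1 : ∀ r, (bigStep h C r).tokens +
      h * (if ¬ Accepts h C (ident r) then (proposers C (ident r)).card else 0) =
      (C r).tokens + if Accepts h C (ident r) then (proposers C (ident r)).card else 0 := by
    intro r
    rw [bigStep_tokens, hC.ident_eq]
    by_cases ha : Accepts h C (ident r)
    · simp [ha]
    -- Rejection means `2 * h * p < tokens`, so the subtraction of `h * p` is not truncated.
    · have := ha
      rw [accepts_iff hC hinj] at this
      simp only [ha, if_false, not_false_eq_true, if_true, add_zero]
      rw [mul_assoc] at this
      omega
  have h2 := Finset.sum_congr (s₁ := (Finset.univ : Finset V)) rfl fun r _ => h1 r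
  rw [Finset.sum_add_distrib, Finset.sum_add_distrib, ← Finset.mul_sum, hacc, hrej] at h2
  have h3 : ∑ v, (bigStep h C v).moves = ∑ v, (C v).moves +
      (Finset.univ.filter fun v => ∃ i, target C v = some i ∧
        Accepts h C (curLab C (P.nbr v i))).card := by
    simp_rw [bigStep_moves]
    rw [Finset.sum_add_distrib, Finset.card_filter]
    exact congrArg _ (Finset.sum_congr rfl fun v _ => if_congr Iff.rfl rfl rfl)
  have h4 : (S.filter fun v => (bigStep h C v).alive = false).card =
      (S.filter fun v => (C v).alive = false).card +
      (Finset.univ.filter fun v => ∃ i, target C v = some i ∧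
        ¬ Accepts h C (curLab C (P.nbr v i))).card := by
    rw [← Finset.card_union_of_disjoint]
    · congr 1
      ext v
      have := bigStep_alive_iff (h := h) (C := C) v
      simp only [Finset.mem_filter, Finset.mem_univ, true_and, Finset.mem_union]
      rw [← Bool.not_eq_true, this]
      constructor
      · rintro ⟨hS, hv⟩
        by_cases ha : (C v).alive
        · exact Or.inr (by_contra fun hd => hv ⟨ha, hd⟩)
        · exact Or.inl ⟨hS, by simpa using ha⟩
      · rintro (⟨hS, hv⟩ | hd)
        · exact ⟨hS, by simp [hv]⟩
        · exact ⟨hI.mem_of_alive v (target_some hd.choose_spec.1).1, fun hv => hv.2 hd⟩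
    · rw [Finset.disjoint_left]
      intro v hv hd
      obtain ⟨i, hi, -⟩ := (Finset.mem_filter.1 hd).2
      have := (Finset.mem_filter.1 hv).2
      rw [(target_some hi).1] at this
      cases this
  have h5 := hI.tokens_eq
  rw [h3, h4, mul_add]
  omega

theorem Invariant.bigStep {S : Finset V} {τ : ℕ} (hI : Invariant S ident h C τ)
    (hC : WellFormed ident C t) (hinj : Function.Injective ident) :
    Invariant S ident h (bigStep h C) τ where
  mem_of_alive v hv := hI.mem_of_alive v (bigStep_of_alive hv).1
  root_mem v hv := by
    obtain ⟨ha, ⟨-, h2, -⟩ | ⟨i, h1, -, h2, -⟩⟩ := bigStep_of_alive hv <;> rw [h2]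
    · exact hI.root_mem v ha
    · exact hI.root_mem _ (target_some h1).2.1
  lev_eq v r hv := by
    rw [bigStep_rootLev]
    obtain ⟨ha, ⟨-, h2, h3, -⟩ | ⟨i, h1, -, h2, h3, -⟩⟩ := bigStep_of_alive hv <;> rw [h2, h3]
    · exact hI.lev_eq v r ha
    · exact hI.lev_eq _ r (target_some h1).2.1
  agree := by
    -- A move goes to a neighbour of no higher level, with whose label the old one agreed up to that
    -- level; so the relevant low bits of the label do not change.
    have key : ∀ u, (BallCarving.bigStep h C u).alive → (C u).alive ∧
        (BallCarving.bigStep h C u).lev ≤ (C u).lev ∧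
        curLab (BallCarving.bigStep h C) u ≡ curLab C u
          [MOD 2 ^ (BallCarving.bigStep h C u).lev] := by
      intro u hu
      obtain ⟨ha, ⟨-, h2, h3, -⟩ | ⟨i, h1, -, h2, h3, -⟩⟩ := bigStep_of_alive hu <;> rw [h2, h3]
      · exact ⟨ha, le_rfl, rfl⟩
      · obtain ⟨-, hn, hlt, -⟩ := target_some h1
        have hl := lev_le_of_curKey_le hlt.le
        have := hI.agree _ _ hn ha (P.adj_nbr u i).symm
        rw [min_eq_left hl] at this
        exact ⟨ha, hl, this⟩
    intro u w hu hw huw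
    obtain ⟨hu1, hu2, hu3⟩ := key u hu
    obtain ⟨hw1, hw2, hw3⟩ := key w hw
    refine ((hu3.of_dvd (pow_dvd_pow 2 (min_le_left _ _))).trans
      ((hI.agree u w hu1 hw1 huw).of_dvd (pow_dvd_pow 2 (min_le_min hu2 hw2)))).trans
      (hw3.of_dvd (pow_dvd_pow 2 (min_le_right _ _))).symm
  moves_add_le v hv := by
    obtain ⟨ha, ⟨-, h2, h3, h4⟩ | ⟨i, h1, -, h2, h3, h4⟩⟩ := bigStep_of_alive hv <;>
      rw [curKey_eq, h2, h3, h4]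
    · exact hI.moves_add_le v ha
    · have := hI.moves_add_le v ha
      have hlt := (target_some h1).2.2.1
      rw [curKey_eq C (P.nbr v i)] at hlt
      omega
  moves_le v := by
    classical
    rw [bigStep_moves]
    split_ifs with hj
    -- A node that moves had a positive key, since a smaller one exists; this leaves room for the
    -- extra move.
    · obtain ⟨i, hi, -⟩ := hj
      have h1 := target_some hi
      have := hI.moves_add_le v h1.1
      omega
    · exact hI.moves_le v
  moves_eq v hv := by
    classical
    rw [bigStep_moves, hI.moves_eq v hv, if_neg]
    rintro ⟨i, hi, -⟩
    exact hv (hI.mem_of_alive v (target_some hi).1)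
  num_le v := bigStep_num_le v (hI.num_le v)
  lev_le v := bigStep_lev_le v hI.lev_le
  tokens_eq := tokens_bigStep hI hC hinj

/-- The end of a phase preserves the invariants. -/
theorem Invariant.raise {S : Finset V} {τ : ℕ} (hI : Invariant S ident h C τ)
    (hok : ∀ v r, (C v).alive → ident r = curLab C v → (C v).ok = (C r).rootOk)
    (hset : ∀ r, (C r).rootOk = false → Settled C (ident r)) :
    Invariant S ident h (fun v => (C v).raise) (τ + 1) where
  mem_of_alive := hI.mem_of_alive
  root_mem := hI.root_mem
  lev_eq v r hv hr := by
    change (if (C v).ok then (C v).lev else (C v).lev + 1) =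
      if (C r).rootOk then (C r).rootLev else (C r).rootLev + 1
    rw [hok v r hv hr, hI.lev_eq v r hv hr]
  agree u w hu hw huw := by
    change curLab C u ≡ curLab C w [MOD 2 ^ min (if (C u).ok then (C u).lev else (C u).lev + 1)
      (if (C w).ok then (C w).lev else (C w).lev + 1)]
    have h0 := hI.agree u w hu hw huw
    have hs : ∀ u, (C u).alive → (C u).ok = false → Settled C (curLab C u) := by
      intro u hu ho
      obtain ⟨r, -, hr⟩ := hI.root_mem u hu
      rw [← hr]
      exact hset r (by rw [← hok u r hu hr, ho])
    cases hou : (C u).ok <;> cases how : (C w).ok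
    -- Both clusters rise: being settled, they have equal keys, hence the same level and the same
    -- bit at that level.
    · have hk : curKey C u = curKey C w := le_antisymm (hs w hw how w u hw rfl huw.symm hu)
        (hs u hu hou u w hu rfl huw hw)
      have hl : (C u).lev = (C w).lev :=
        le_antisymm (lev_le_of_curKey_le hk.le) (lev_le_of_curKey_le hk.ge)
      simp only [Bool.false_eq_true, if_false]
      rw [hl, min_self] at h0 ⊢
      refine modEq_two_pow_succ h0 ?_
      rw [curKey_eq, curKey_eq, hl] at hk
      cases h1 : (curLab C u).testBit (C w).lev <;> cases h2 : (curLab C w).testBit (C w).lev <;>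
        simp [h1, h2] at hk ⊢
    -- Only one cluster rises, and its level was not below the other, so the minimum stays.
    · have hl := lev_le_of_curKey_le (hs u hu hou u w hu rfl huw hw)
      simp only [Bool.false_eq_true, if_false, if_true]
      rwa [min_eq_right (by omega), ← min_eq_right hl]
    · have hl := lev_le_of_curKey_le (hs w hw how w u hw rfl huw.symm hu)
      simp only [Bool.false_eq_true, if_false, if_true]
      rwa [min_eq_left (by omega), ← min_eq_left hl]
    · exact h0
  moves_add_le v hv := by
    have := hI.moves_add_le v hv
    rw [curKey_eq] at this ⊢
    simp only [Core.raise, curLab] at this ⊢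
    split_ifs at this ⊢ <;> omega
  moves_le v := (hI.moves_le v).trans (by omega)
  moves_eq := hI.moves_eq
  num_le := hI.num_le
  lev_le v := by
    have := hI.lev_le v
    simp only [Core.raise]
    split_ifs <;> omega
  tokens_eq := hI.tokens_eq

/-! ### Phases and the growth of the tokens. -/

theorem WellFormed.bigStep_iterate (hC : WellFormed ident C t) (s : ℕ) :
    WellFormed ident ((BallCarving.bigStep h)^[s] C) (t + s) := by
  induction s with
  | zero => exact hC
  | succ s ih =>
    rw [Function.iterate_succ_apply']
    exact ih.bigStep

theorem Invariant.bigStep_iterate {S : Finset V} {τ : ℕ} (hI : Invariant S ident h C τ)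
    (hC : WellFormed ident C t) (hinj : Function.Injective ident) (s : ℕ) :
    Invariant S ident h ((BallCarving.bigStep h)^[s] C) τ := by
  induction s with
  | zero => exact hI
  | succ s ih =>
    rw [Function.iterate_succ_apply']
    exact ih.bigStep (hC.bigStep_iterate s) hinj

/-- A phase with `s` steps. -/
noncomputable def phase (h s : ℕ) (C : ∀ v, Core (P.deg v)) : ∀ v, Core (P.deg v) :=
  fun v => ((bigStep h)^[s] C v).raise

theorem WellFormed.phase (hC : WellFormed ident C t) (s : ℕ) :
    WellFormed ident (phase h s C) (t + s) :=
  (hC.bigStep_iterate s).raise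

theorem Invariant.phase {S : Finset V} {τ : ℕ} (hI : Invariant S ident h C τ)
    (hC : WellFormed ident C t) (hinj : Function.Injective ident) {s : ℕ} (hs : 0 < s) :
    Invariant S ident h (phase h s C) (τ + 1) := by
  classical
  refine (hI.bigStep_iterate hC hinj s).raise ?_ ?_ <;>
    obtain ⟨s, rfl⟩ := Nat.exists_eq_add_of_lt hs <;>
    simp only [zero_add, Function.iterate_succ_apply']
  · intro v r hv hr
    rw [bigStep_ok hv, bigStep_rootOk, (hC.bigStep_iterate s).ident_eq, hr]
  · intro r hr
    rw [bigStep_rootOk, (hC.bigStep_iterate s).ident_eq] at hr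
    exact settled_of_not_accepts (of_decide_eq_false hr)

/-- In a step of a phase that has started with `t₀` tokens, a cluster either accepts, having done
so before, or is settled afterwards. -/
theorem tokens_step (hC : WellFormed ident C t) (hinj : Function.Injective ident) (r : V)
    (hh : 0 < h) {t₀ s : ℕ} (ht₀ : 0 < t₀)
    (hr : (2 * h + s) * t₀ ≤ 2 * h * (C r).tokens ∨
      Settled C (ident r) ∧ t₀ ≤ 2 * (C r).tokens) :
    (bigStep h C r).rootOk = true ∧
        (2 * h + (s + 1)) * t₀ ≤ 2 * h * (bigStep h C r).tokens ∨
      (bigStep h C r).rootOk = false ∧ Settled (bigStep h C) (ident r) ∧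
        t₀ ≤ 2 * (bigStep h C r).tokens := by
  classical
  rw [bigStep_rootOk, bigStep_tokens, hC.ident_eq]
  rcases hr with hr | ⟨hs, hr⟩
  · have hle : t₀ ≤ (C r).tokens := by
      refine Nat.le_of_mul_le_mul_left ((Nat.mul_le_mul_right t₀ ?_).trans hr) (by omega : 0 < 2 * h)
      omega
    by_cases ha : Accepts h C (ident r)
    · left
      have ha' := (accepts_iff hC hinj r).1 ha
      rw [if_pos ha]
      refine ⟨decide_eq_true ha, ?_⟩
      rw [mul_add, ← add_assoc, add_mul, one_mul]
      omega
    · right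
      have ha' := mt (accepts_iff hC hinj r).2 ha
      rw [if_neg ha]
      refine ⟨decide_eq_false ha, settled_of_not_accepts ha, ?_⟩
      rw [mul_assoc] at ha'
      omega
  · have hp := hs.proposers_eq_empty
    -- With tokens left and no proposals the test fails again, at no cost. So the decision of the
    -- last step tells whether the cluster has settled during the phase.
    have ha : ¬ Accepts h C (ident r) := by
      rw [accepts_iff hC hinj, hp, Finset.card_empty]
      omega
    right
    rw [if_neg ha, hp]
    exact ⟨decide_eq_false ha, hs.bigStep, by simpa using hr⟩

theorem tokens_iterate (hC : WellFormed ident C t) (hinj : Function.Injective ident) (r : V)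
    (hh : 0 < h) (hr : 0 < (C r).tokens) (s : ℕ) :
    (2 * h + s) * (C r).tokens ≤ 2 * h * ((bigStep h)^[s] C r).tokens ∨
      Settled ((bigStep h)^[s] C) (ident r) ∧
        (C r).tokens ≤ 2 * ((bigStep h)^[s] C r).tokens := by
  induction s with
  | zero => exact Or.inl le_rfl
  | succ s ih =>
    rw [Function.iterate_succ_apply']
    exact (tokens_step (hC.bigStep_iterate s) hinj r hh hr ih).imp And.right And.right

theorem rootLev_iterate (s : ℕ) (r : V) : ((bigStep h)^[s] C r).rootLev = (C r).rootLev := by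
  induction s with
  | zero => rfl
  | succ s ih => rw [Function.iterate_succ_apply', bigStep_rootLev, ih]

/-- In a phase, a cluster doubles its tokens, or it keeps at least half of them and enters the
next level. -/
theorem tokens_phase (hC : WellFormed ident C t) (hinj : Function.Injective ident) (r : V)
    (hh : 0 < h) {τ : ℕ} (hr : 2 ^ τ ≤ (C r).tokens * 4 ^ (C r).rootLev) :
    2 ^ (τ + 1) ≤ (phase h (2 * h) C r).tokens * 4 ^ (phase h (2 * h) C r).rootLev := by
  have hpos : 0 < (C r).tokens := by
    rcases Nat.eq_zero_or_pos (C r).tokens with h0 | h0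
    · rw [h0, zero_mul] at hr
      exact absurd hr (Nat.two_pow_pos τ).not_ge
    · exact h0
  -- The last step is split off, because `tokens_iterate` does not record the decision that `raise`
  -- uses.
  obtain ⟨s, hs⟩ : ∃ s, 2 * h = s + 1 := ⟨2 * h - 1, by omega⟩
  have key := tokens_step (hC.bigStep_iterate s) hinj r hh hpos
    (tokens_iterate hC hinj r hh hpos s)
  rw [← Function.iterate_succ_apply' (bigStep h), Nat.succ_eq_add_one, ← hs] at key
  have hl := rootLev_iterate (h := h) (C := C) (2 * h) r
  change _ ≤ ((bigStep h)^[2 * h] C r).tokens * 4 ^ (if ((bigStep h)^[2 * h] C r).rootOk then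
    ((bigStep h)^[2 * h] C r).rootLev else ((bigStep h)^[2 * h] C r).rootLev + 1)
  rw [hl]
  rcases key with ⟨ho, hk⟩ | ⟨ho, -, hk⟩
  · rw [ho, if_pos rfl]
    have : 2 * (C r).tokens ≤ ((bigStep h)^[2 * h] C r).tokens := by
      refine Nat.le_of_mul_le_mul_left (le_trans (le_of_eq ?_) hk) (by omega : 0 < 2 * h)
      ring
    calc 2 ^ (τ + 1) ≤ 2 * ((C r).tokens * 4 ^ (C r).rootLev) := by rw [pow_succ]; omega
      _ = 2 * (C r).tokens * 4 ^ (C r).rootLev := by ring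
      _ ≤ _ := Nat.mul_le_mul_right _ this
  · rw [ho, if_neg (by simp)]
    calc 2 ^ (τ + 1) ≤ 2 * ((C r).tokens * 4 ^ (C r).rootLev) := by rw [pow_succ]; omega
      _ = (C r).tokens * (2 * 4 ^ (C r).rootLev) := by ring
      _ ≤ 2 * ((bigStep h)^[2 * h] C r).tokens * (2 * 4 ^ (C r).rootLev) :=
        Nat.mul_le_mul_right _ hk
      _ = _ := by ring

end

end BallCarving

/-! ### The outputs describe Steiner trees. -/

/-- A connected graph all of whose edges join a vertex other than `root` to its parent is a
tree. -/
theorem SimpleGraph.Connected.isTree_of_parent {W : Type*} [Finite W] {H : SimpleGraph W}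
    (hH : H.Connected) (root : W) (par : W → W)
    (hadj : ∀ u v, H.Adj u v → (u ≠ root ∧ par u = v) ∨ (v ≠ root ∧ par v = u)) : H.IsTree := by
  rw [SimpleGraph.isTree_iff_connected_and_card]
  refine ⟨hH, le_antisymm ?_ hH.card_vert_le_card_edgeSet_add_one⟩
  -- Non-root vertices account for all edges, so there are at most `card W - 1` of them.
  have hsub : H.edgeSet ⊆ (fun v => s(v, par v)) '' {root}ᶜ := by
    intro e he
    induction e with
    | _ u v =>
      rcases hadj u v he with ⟨h, rfl⟩ | ⟨h, rfl⟩
      · exact ⟨u, h, rfl⟩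
      · exact ⟨v, h, Sym2.eq_swap⟩
  have h1 := (Set.ncard_le_ncard hsub (Set.toFinite _)).trans (Set.ncard_image_le (Set.toFinite _))
  have h2 := Set.ncard_add_ncard_compl {root}
  rw [Set.ncard_singleton] at h2
  rw [Nat.card_coe_set_eq]
  omega

namespace BallCarving

theorem IsBallCarving.mono {V : Type*} {G : SimpleGraph V} {P : PortNumbering G} {S : Set V}
    {out : ∀ v : V, LocalOutput (P.deg v)} {D R M D' R' M' : ℕ}
    (h : IsBallCarving S out D R M) (hD : D ≤ D') (hR : R ≤ R') (hM : M ≤ M') :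
    IsBallCarving S out D' R' M' where
  subset := h.subset
  half := h.half
  nonadjacent := h.nonadjacent
  weakDiam ℓ u hu v hv := (h.weakDiam ℓ u hu v hv).trans (by exact_mod_cast hD)
  steiner ℓ hℓ := ⟨(h.steiner ℓ hℓ).1, (h.steiner ℓ hℓ).2.trans (by exact_mod_cast hR)⟩
  overlap v := (h.overlap v).trans (by exact_mod_cast hM)

open Classical in
/-- The output of a node. -/
noncomputable def Core.output {d : ℕ} (c : Core d) : LocalOutput d where
  cluster := if c.alive then some (c.lab c.cur) else none
  tree ℓ := if h : ∃ j, j < c.num ∧ c.lab j = ℓ then some ((c.par (Nat.find h)).map Prod.fst)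
    else none

section

variable {V : Type*} {G : SimpleGraph V} {P : PortNumbering G}
  {ident : V → ℕ} {C : ∀ v, Core (P.deg v)} {t h : ℕ}

theorem mem_verts_iff {ℓ : ℕ} {v : V} :
    v ∈ (steinerGraph (fun v => (C v).output) ℓ).verts ↔
      ∃ j, j < (C v).num ∧ (C v).lab j = ℓ := by
  simp only [steinerGraph, Core.output, Set.mem_ofPred_eq]
  split_ifs with h <;> simp [h]

theorem mem_cluster_iff {ℓ : ℕ} {v : V} :
    v ∈ cluster (fun v => (C v).output) ℓ ↔ (C v).alive ∧ curLab C v = ℓ := by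
  simp only [cluster, Core.output, Set.mem_ofPred_eq]
  split_ifs with h <;> simp [h]

theorem mem_clustered_iff {v : V} :
    v ∈ clustered (fun v => (C v).output) ↔ (C v).alive := by
  simp only [clustered, Core.output, Set.mem_ofPred_eq]
  split_ifs with h <;> simp [h]

theorem WellFormed.tree_eq (hC : WellFormed ident C t) {v : V} {j : ℕ} (hj : j < (C v).num) :
    (C v).output.tree ((C v).lab j) = some (((C v).par j).map Prod.fst) := by
  classical
  have hex : ∃ j', j' < (C v).num ∧ (C v).lab j' = (C v).lab j := ⟨j, hj, rfl⟩
  have e : Nat.find hex = j :=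
    hC.lab_inj v _ _ (Nat.find_spec hex).1 hj (Nat.find_spec hex).2
  simp only [Core.output, dif_pos hex, e]

/-- The parent of a node in the tree number `j`, if there is one, is unique. -/
theorem WellFormed.isParent_iff (hC : WellFormed ident C t) {v w : V} {j : ℕ}
    (hj : j < (C v).num) :
    IsParent (fun v => (C v).output) ((C v).lab j) v w ↔
      ∃ i q, (C v).par j = some (i, q) ∧ P.nbr v i = w := by
  simp only [IsParent, hC.tree_eq hj, Option.some.injEq, Option.map_eq_some_iff, Prod.exists,
    exists_and_right, exists_eq_right]

theorem WellFormed.mem_verts_root (hC : WellFormed ident C t) (r : V) :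
    r ∈ (steinerGraph (fun v => (C v).output) (ident r)).verts :=
  mem_verts_iff.2 ⟨0, hC.num_pos r, hC.lab_zero r⟩

/-- Each node of a tree is joined to the root by a path of length its depth. -/
theorem WellFormed.exists_walk (hC : WellFormed ident C t) (hinj : Function.Injective ident)
    (r : V) (k : ℕ) : ∀ (v : V) (j : ℕ), j < (C v).num → (C v).lab j = ident r →
    (C v).dep j = k → ∀ hv : v ∈ (steinerGraph (fun v => (C v).output) (ident r)).verts,
    ∃ w : (steinerGraph (fun v => (C v).output) (ident r)).coe.Walk ⟨r, hC.mem_verts_root r⟩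
      ⟨v, hv⟩, w.length = k := by
  induction k with
  | zero =>
    intro v j hj hl hd hv
    have hj0 : j = 0 := by
      by_contra h0
      obtain ⟨i, q, -, -, -, h⟩ := hC.par_of_lt v j (Nat.pos_of_ne_zero h0) hj
      omega
    subst hj0
    obtain rfl : v = r := hinj ((hC.lab_zero v).symm.trans hl)
    exact ⟨SimpleGraph.Walk.nil, rfl⟩
  | succ k ih =>
    intro v j hj hl hd hv
    have h0 : 0 < j := by
      refine Nat.pos_of_ne_zero fun h0 => ?_
      rw [h0, hC.dep_zero] at hd
      omega
    obtain ⟨i, q, h1, h2, h3, h4⟩ := hC.par_of_lt v j h0 hj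
    have hmem : P.nbr v i ∈ (steinerGraph (fun v => (C v).output) (ident r)).verts :=
      mem_verts_iff.2 ⟨q, h2, h3.trans hl⟩
    obtain ⟨w, hw⟩ := ih (P.nbr v i) q h2 (h3.trans hl) (by omega) hmem
    have hadj : (steinerGraph (fun v => (C v).output) (ident r)).coe.Adj ⟨P.nbr v i, hmem⟩
        ⟨v, hv⟩ := by
      have hp := (hC.isParent_iff hj).2 ⟨i, q, h1, rfl⟩
      rw [hl] at hp
      exact ⟨⟨hmem, hv⟩, Or.inr hp⟩
    exact ⟨w.concat hadj, by rw [SimpleGraph.Walk.length_concat, hw]⟩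

theorem WellFormed.edist_root_le (hC : WellFormed ident C t) (hinj : Function.Injective ident)
    (r : V) (v : (steinerGraph (fun v => (C v).output) (ident r)).verts) :
    (steinerGraph (fun v => (C v).output) (ident r)).coe.edist ⟨r, hC.mem_verts_root r⟩ v ≤ t ∧
      G.edist r v ≤ t := by
  obtain ⟨v, hv⟩ := v
  obtain ⟨j, hj, hl⟩ := mem_verts_iff.1 hv
  obtain ⟨w, hw⟩ := hC.exists_walk hinj r _ v j hj hl rfl hv
  have hle : (w.length : ℕ∞) ≤ t := by
    rw [hw]
    exact_mod_cast hC.dep_le v j hj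
  refine ⟨w.edist_le.trans hle, ?_⟩
  have := (w.map (steinerGraph (fun v => (C v).output) (ident r)).hom).edist_le
  rw [SimpleGraph.Walk.length_map] at this
  exact this.trans hle

theorem WellFormed.isSteinerTree [Finite V] (hC : WellFormed ident C t)
    (hinj : Function.Injective ident) (r : V) :
    IsSteinerTree (steinerGraph (fun v => (C v).output) (ident r))
        (cluster (fun v => (C v).output) (ident r)) ∧
      (steinerGraph (fun v => (C v).output) (ident r)).coe.radius ≤ t := by
  set T := steinerGraph (fun v => (C v).output) (ident r) with hT
  let r' : T.verts := ⟨r, hC.mem_verts_root r⟩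
  have hd : ∀ v : T.verts, T.coe.edist r' v ≤ t := fun v => (hC.edist_root_le hinj r v).1
  have hconn : T.coe.Connected := by
    have hreach : ∀ v : T.verts, T.coe.Reachable r' v := fun v =>
      SimpleGraph.reachable_of_edist_ne_top (ne_top_of_le_ne_top (ENat.natCast_ne_top t) (hd v))
    exact { preconnected := fun u v => (hreach u).symm.trans (hreach v), nonempty := ⟨r'⟩ }
  refine ⟨⟨?_, ?_⟩, ?_⟩
  · have hpar : ∀ v : T.verts, ∃ w : T.verts, ∀ u : T.verts,
        IsParent (fun v => (C v).output) (ident r) v u → v ≠ r' ∧ w = u := by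
      rintro ⟨v, hv⟩
      obtain ⟨j, hj, hl⟩ := mem_verts_iff.1 hv
      by_cases hex : ∃ u : T.verts, IsParent (fun v => (C v).output) (ident r) v u
      · obtain ⟨w, hw⟩ := hex
        refine ⟨w, fun u hu => ?_⟩
        rw [← hl, hC.isParent_iff hj] at hu hw
        obtain ⟨i, q, h1, h2⟩ := hu
        obtain ⟨i', q', h1', h2'⟩ := hw
        rw [h1] at h1'
        cases h1'
        refine ⟨fun h => ?_, Subtype.ext (h2'.symm.trans h2)⟩
        obtain rfl : v = r := congrArg Subtype.val h
        -- The root holds its own tree under number 0, where there is no parent.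
        have := (hC.of_par h1).1
        rw [hC.lab_inj v j 0 hj (hC.num_pos v) (hl.trans (hC.lab_zero v).symm)] at this
        exact this.false
      · exact ⟨⟨v, hv⟩, fun u hu => absurd ⟨u, hu⟩ hex⟩
    choose par hpar using hpar
    exact hconn.isTree_of_parent r' par fun u v huv =>
      huv.2.imp (fun h => hpar u v h) fun h => hpar v u h
  · intro v hv
    obtain ⟨-, hl⟩ := mem_cluster_iff.1 hv
    exact mem_verts_iff.2 ⟨_, hC.cur_lt v, hl⟩
  · exact SimpleGraph.radius_le_eccent.trans (iSup_le hd : T.coe.eccent r' ≤ t)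

end

/-! ### The final accounting: levels, survivors and overlap. -/

section

variable {V : Type*} {G : SimpleGraph V} {P : PortNumbering G} [Fintype V]
  {ident : V → ℕ} {C : ∀ v, Core (P.deg v)} {t h : ℕ}

theorem Invariant.sum_moves_le {S : Finset V} {τ : ℕ} (hI : Invariant S ident h C τ) :
    S.card + ∑ v, (C v).moves ≤ S.card * (3 * τ + 2) := by
  have h1 : ∑ v, (C v).moves = ∑ v ∈ S, (C v).moves :=
    (Finset.sum_subset (Finset.subset_univ S) fun v _ hv => hI.moves_eq v hv).symm
  have h2 := Finset.sum_le_card_nsmul S (fun v => (C v).moves) _ fun v _ => hI.moves_le v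
  rw [smul_eq_mul] at h2
  rw [h1]
  linarith

/-- After `8 b` phases all clusters have level at least `b`. -/
theorem Invariant.le_lev {S : Finset V} {b : ℕ} (hb : 0 < b)
    (hI : Invariant S ident h C (8 * b)) (hcard : Fintype.card V ≤ 2 ^ b)
    (htok : ∀ r ∈ S, 2 ^ (8 * b) ≤ (C r).tokens * 4 ^ (C r).rootLev) {v : V}
    (hv : (C v).alive) : b ≤ (C v).lev := by
  by_contra! hlt
  obtain ⟨r, hr, hrv⟩ := hI.root_mem v hv
  rw [hI.lev_eq v r hv hrv] at hlt
  have h1 : (C r).tokens ≤ S.card * (3 * (8 * b) + 2) := by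
    have h2 := Finset.single_le_sum (f := fun r => (C r).tokens) (fun _ _ => Nat.zero_le _)
      (Finset.mem_univ r)
    have h3 := hI.tokens_eq
    have h4 := hI.sum_moves_le
    have h5 : (C r).tokens ≤ ∑ r, (C r).tokens := h2
    omega
  have h2 : S.card ≤ 2 ^ b := (Finset.card_le_univ S).trans hcard
  -- The potential has reached `2 ^ (8b)`, but the tokens are bounded and a level below `b`
  -- contributes less than `4 ^ b`. This leaves `32 ^ b ≤ 24b + 2`, which is absurd.
  have h3 : 2 ^ (8 * b) ≤ 2 ^ b * (24 * b + 2) * 4 ^ b := by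
    refine (htok r hr).trans (Nat.mul_le_mul (h1.trans ?_) (Nat.pow_le_pow_right (by omega) hlt.le))
    rw [show 3 * (8 * b) + 2 = 24 * b + 2 by ring]
    exact Nat.mul_le_mul_right _ h2
  have h4 : 2 ^ (8 * b) = 2 ^ b * 32 ^ b * 4 ^ b := by
    rw [show (32 : ℕ) = 2 ^ 5 by norm_num, show (4 : ℕ) = 2 ^ 2 by norm_num, ← pow_mul, ← pow_mul,
      ← pow_add, ← pow_add]
    congr 1
    ring
  rw [h4] at h3
  have h5 : 32 ^ b ≤ 24 * b + 2 :=
    Nat.le_of_mul_le_mul_left (Nat.le_of_mul_le_mul_right h3 (by positivity)) (Nat.two_pow_pos b)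
  have h6 : ∀ k, 31 * k + 1 ≤ 32 ^ k := by
    intro k
    induction k with
    | zero => simp
    | succ k ih => rw [pow_succ]; omega
  have := h6 b
  omega

/-- The outputs after `8 b` phases describe a ball carving. -/
theorem isBallCarving_output {S : Finset V} {b : ℕ} (hb : 0 < b)
    (hinj : Function.Injective ident) (hident : ∀ v, ident v < 2 ^ b)
    (hC : WellFormed ident C t) (hI : Invariant S ident (52 * b) C (8 * b))
    (hcard : Fintype.card V ≤ 2 ^ b)
    (htok : ∀ r ∈ S, 2 ^ (8 * b) ≤ (C r).tokens * 4 ^ (C r).rootLev) :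
    IsBallCarving (S : Set V) (fun v => (C v).output) (2 * t) t (24 * b + 2) where
  subset v hv := hI.mem_of_alive v (mem_clustered_iff.1 hv)
  half := by
    have h1 := hI.tokens_eq
    have h2 := hI.sum_moves_le
    -- The tokens and moves total at most `(24b + 2) * card S ≤ 26b * card S`; the price `52b` is
    -- twice that factor.
    have h3 : 52 * b * (S.filter fun v => (C v).alive = false).card ≤ S.card * (26 * b) := by
      refine (by omega : _ ≤ S.card * (3 * (8 * b) + 2)).trans (Nat.mul_le_mul_left _ (by omega))
    have h4 : 2 * (S.filter fun v => (C v).alive = false).card ≤ S.card := by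
      refine Nat.le_of_mul_le_mul_left (le_trans (le_of_eq ?_) (h3.trans (le_of_eq ?_)))
        (by omega : 0 < 26 * b) <;> ring
    have h5 : clustered (fun v => (C v).output) =
        ((S.filter fun v => ¬ (C v).alive = false : Finset V) : Set V) := by
      ext v
      rw [mem_clustered_iff]
      simp only [Bool.not_eq_false, Finset.coe_filter, Set.mem_ofPred_eq]
      exact ⟨fun h => ⟨hI.mem_of_alive v h, h⟩, And.right⟩
    have h6 := Finset.card_filter_add_card_filter_not (s := S) fun v => (C v).alive = false
    rw [h5, Set.ncard_coe_finset, Set.ncard_coe_finset]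
    omega
  nonadjacent ℓ ℓ' hne u hu v hv huv := by
    obtain ⟨hua, rfl⟩ := mem_cluster_iff.1 hu
    obtain ⟨hva, rfl⟩ := mem_cluster_iff.1 hv
    refine hne (Nat.ModEq.eq_of_lt_of_lt ((hI.agree u v hua hva huv).of_dvd (pow_dvd_pow 2
      (le_min (hI.le_lev hb hcard htok hua) (hI.le_lev hb hcard htok hva)))) ?_ ?_)
    · obtain ⟨r, -, hr⟩ := hI.root_mem u hua
      exact hr ▸ hident r
    · obtain ⟨r, -, hr⟩ := hI.root_mem v hva
      exact hr ▸ hident r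
  weakDiam ℓ u hu v hv := by
    obtain ⟨hua, rfl⟩ := mem_cluster_iff.1 hu
    obtain ⟨r, hr⟩ := hC.exists_root u _ (hC.cur_lt u)
    obtain ⟨-, hvl⟩ := mem_cluster_iff.1 hv
    have h1 := (hC.edist_root_le hinj r ⟨u, mem_verts_iff.2 ⟨_, hC.cur_lt u, hr.symm⟩⟩).2
    have h2 := (hC.edist_root_le hinj r
      ⟨v, mem_verts_iff.2 ⟨_, hC.cur_lt v, hvl.trans hr.symm⟩⟩).2
    rw [SimpleGraph.edist_comm] at h1
    refine (G.edist_triangle (v := r)).trans ((add_le_add h1 h2).trans (le_of_eq ?_))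
    push_cast
    ring
  steiner ℓ hℓ := by
    obtain ⟨v, hv⟩ := hℓ
    obtain ⟨-, rfl⟩ := mem_cluster_iff.1 hv
    obtain ⟨r, hr⟩ := hC.exists_root v _ (hC.cur_lt v)
    rw [curLab, ← hr]
    exact hC.isSteinerTree hinj r
  overlap v := by
    have hsub : {ℓ : ℕ | v ∈ (steinerGraph (fun v => (C v).output) ℓ).verts} ⊆
        ((Finset.range (C v).num).image (C v).lab : Finset ℕ) := by
      intro ℓ hℓ
      obtain ⟨j, hj, hl⟩ := mem_verts_iff.1 hℓ
      simp only [Finset.coe_image, Set.mem_image, Finset.coe_range, Set.mem_Iio]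
      exact ⟨j, hj, hl⟩
    refine (Set.encard_le_encard hsub).trans ?_
    rw [Set.encard_coe_eq_coe_finsetCard]
    have h1 := Finset.card_image_le (s := Finset.range (C v).num) (f := (C v).lab)
    rw [Finset.card_range] at h1
    have h2 := hI.num_le v
    have h3 := hI.moves_le v
    exact_mod_cast (by omega : _ ≤ 24 * b + 2)

end

/-! ### Parameters and assembly of the algorithm. -/

/-- The rounds of a phase with `s` steps. -/
noncomputable def Params.phaseRounds (p : Params) (s : ℕ) : List (Round p.width Node) :=
  (List.replicate s p.stepRounds).flatten ++ [p.raise]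

/-- The initial state of a node. -/
def Node.start (d : ℕ) (x : LocalInput) : Node d where
  core := Core.start d x
  nb _ := ⟨false, 0, 0, 0, 0⟩
  target := none
  carry _ := 0
  out _ := false
  count := 0
  dn _ := false

/-- The parameters for identifiers of `b` bits. -/
def params (b : ℕ) : Params where
  -- `D` is the number of steps, `8b * 104b`. `U` ensures `2 ^ D * n < 2 ^ U` for `n ≤ 2 ^ b`. `M`
  -- is `3τ + 2` at `τ = 8b`. `W` is generous enough for labels, levels, tree numbers and depths.
  D := 832 * b ^ 2
  U := 832 * b ^ 2 + b + 1
  M := 24 * b + 2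
  W := 12 * b
  h := 52 * b

/-- The ball carving algorithm: `8 b` phases with `104 b` steps each. -/
noncomputable def algorithm (B b k : ℕ) : CongestAlgorithm B LocalInput LocalOutput :=
  Round.compile B k (List.replicate (8 * b) ((params b).phaseRounds (104 * b))).flatten
    Node.start fun _ s => s.core.output

theorem Params.length_stepRounds (p : Params) : p.stepRounds.length = p.U + p.D + 4 := by
  simp [stepRounds]
  omega

theorem rounds_algorithm_le (B b k : ℕ) : (algorithm B b k).rounds ≤ k * (1390000 * b ^ 4) := by
  change k * List.length _ ≤ _
  refine Nat.mul_le_mul_left k ?_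
  have h1 : (params b).stepRounds.length = 1664 * b ^ 2 + b + 5 := by
    rw [Params.length_stepRounds]
    simp only [params]
    ring
  simp only [List.length_flatten, List.map_replicate, List.sum_replicate, Params.phaseRounds,
    List.length_append, h1, List.length_singleton, smul_eq_mul]
  rcases Nat.eq_zero_or_pos b with rfl | hb
  · simp
  have h2 : b ≤ b ^ 2 := Nat.le_self_pow two_ne_zero b
  have h3 : 1 ≤ b ^ 2 := Nat.one_le_pow _ _ hb
  have h4 : 1 ≤ b ^ 3 := Nat.one_le_pow _ _ hb
  calc 8 * b * (104 * b * (1664 * b ^ 2 + b + 5) + 1)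
      ≤ 8 * b * (104 * b * (1670 * b ^ 2) + b ^ 3) := by gcongr; omega
    _ = 1389448 * b ^ 4 := by ring
    _ ≤ 1390000 * b ^ 4 := Nat.mul_le_mul_right _ (by norm_num)

section

variable {V : Type*} {G : SimpleGraph V} {P : PortNumbering G}
  {ident : V → ℕ} {p : Params}

theorem wellFormed_start (x : V → LocalInput) (hx : ∀ v, (x v).ident = ident v) :
    WellFormed ident (fun v => Core.start (P.deg v) (x v)) 0 where
  ident_eq := hx
  cur_lt _ := Nat.one_pos
  lab_zero := hx
  dep_zero _ := rfl
  par_zero _ := rfl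
  par_of_le _ _ _ := rfl
  par_of_lt _ j h0 hj := by
    have : j < 1 := hj
    omega
  lab_inj _ j j' hj hj' _ := by
    have : j < 1 := hj
    have : j' < 1 := hj'
    omega
  exists_root v _ _ := ⟨v, (hx v).symm⟩
  dep_le _ _ _ := le_rfl

variable [Fintype V]

/-- The invariants supply the bounds on depths, levels and numbers of trees under which the messages
of a step fit. -/
theorem execList_steps {S : Finset V} (σ : ∀ v, Node (P.deg v)) {t τ : ℕ}
    (hC : WellFormed ident (fun v => (σ v).core) t)
    (hI : Invariant S ident p.h (fun v => (σ v).core) τ) (hinj : Function.Injective ident)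
    (hU : 2 ^ p.D * Fintype.card V < 2 ^ p.U) (hident : ∀ v, ident v < 2 ^ p.W)
    (hM : 3 * τ + 2 ≤ p.M) (hMW : p.M ≤ 2 ^ p.W) (hDW : p.D < 2 ^ p.W) (s : ℕ)
    (hs : t + s ≤ p.D) :
    (fun v => (Round.execList (List.replicate s p.stepRounds).flatten P σ v).core) =
      (bigStep p.h)^[s] fun v => (σ v).core := by
  induction s with
  | zero => rfl
  | succ s ih =>
    have ih := ih (by omega)
    have hC' := hC.bigStep_iterate (h := p.h) s
    have hI' := hI.bigStep_iterate hC hinj s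
    rw [← ih] at hC' hI'
    rw [List.replicate_succ', List.flatten_append, List.flatten_singleton,
      Function.iterate_succ_apply', ← ih]
    funext v
    rw [Round.execList_append]
    refine execList_stepRounds _ hC' hinj (by omega) (fun v => ?_) hU hident (fun v => ?_) hMW hDW v
    · have h1 := hI'.num_le v
      have h2 := hI'.moves_le v
      omega
    · have h1 := hI'.lev_le v
      exact lt_of_le_of_lt h1 (by omega)

theorem execList_phaseRounds {S : Finset V} (σ : ∀ v, Node (P.deg v)) {t τ : ℕ}
    (hC : WellFormed ident (fun v => (σ v).core) t)
    (hI : Invariant S ident p.h (fun v => (σ v).core) τ) (hinj : Function.Injective ident)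
    (hU : 2 ^ p.D * Fintype.card V < 2 ^ p.U) (hident : ∀ v, ident v < 2 ^ p.W)
    (hM : 3 * τ + 2 ≤ p.M) (hMW : p.M ≤ 2 ^ p.W) (hDW : p.D < 2 ^ p.W) (s : ℕ)
    (hs : t + s ≤ p.D) :
    (fun v => (Round.execList (p.phaseRounds s) P σ v).core) =
      phase p.h s fun v => (σ v).core := by
  funext v
  rw [phase, ← execList_steps σ hC hI hinj hU hident hM hMW hDW s hs, Params.phaseRounds,
    Round.execList_append]
  rfl

/-- The state after `τ` phases. -/
theorem execList_phases {S : Finset V} (σ : ∀ v, Node (P.deg v))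
    (hC : WellFormed ident (fun v => (σ v).core) 0)
    (hI : Invariant S ident p.h (fun v => (σ v).core) 0)
    (htok : ∀ r ∈ S, 1 ≤ (σ r).core.tokens) (hinj : Function.Injective ident) (hh : 0 < p.h)
    (hU : 2 ^ p.D * Fintype.card V < 2 ^ p.U) (hident : ∀ v, ident v < 2 ^ p.W)
    (hMW : p.M ≤ 2 ^ p.W) (hDW : p.D < 2 ^ p.W) (τ : ℕ)
    (hM : 3 * τ + 2 ≤ p.M) (hD : τ * (2 * p.h) ≤ p.D) :
    ∃ C : ∀ v, Core (P.deg v),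
      (fun v => (Round.execList (List.replicate τ (p.phaseRounds (2 * p.h))).flatten P σ v).core) =
        C ∧ WellFormed ident C (τ * (2 * p.h)) ∧ Invariant S ident p.h C τ ∧
      ∀ r ∈ S, 2 ^ τ ≤ (C r).tokens * 4 ^ (C r).rootLev := by
  induction τ with
  | zero =>
    refine ⟨_, rfl, ?_, hI, fun r hr => ?_⟩
    · rw [zero_mul]
      exact hC
    · exact (htok r hr).trans (Nat.le_mul_of_pos_right _ (by positivity))
  | succ τ ih =>
    rw [Nat.succ_mul τ (2 * p.h)] at hD
    obtain ⟨C, rfl, hC', hI', htok'⟩ := ih (by omega) (by omega)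
    have key := execList_phaseRounds _ hC' hI' hinj hU hident (by omega) hMW hDW (2 * p.h) hD
    refine ⟨_, ?_, ?_, hI'.phase hC' hinj (by omega : 0 < 2 * p.h),
      fun r hr => tokens_phase hC' hinj r hh (htok' r hr)⟩
    · rw [List.replicate_succ', List.flatten_append, List.flatten_singleton, ← key]
      simp only [Round.execList_append]
    · rw [Nat.succ_mul τ (2 * p.h)]
      exact hC'.phase _

theorem invariant_start (h : ℕ) (S : Finset V) (x : V → LocalInput)
    (hx : ∀ v, (x v).ident = ident v) (hS : ∀ v, (x v).living ↔ v ∈ S) :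
    Invariant S ident h (fun v => Core.start (P.deg v) (x v)) 0 where
  mem_of_alive v hv := (hS v).1 hv
  root_mem v hv := ⟨v, (hS v).1 hv, (hx v).symm⟩
  lev_eq _ _ _ _ := rfl
  agree _ _ _ _ _ := by
    simp only [Core.start, min_self, pow_zero]
    exact Nat.modEq_one
  moves_add_le v _ := by
    change 0 + (2 * 0 + if (x v).ident.testBit 0 then 0 else 1) ≤ 3 * 0 + 1
    split_ifs <;> omega
  moves_le _ := Nat.zero_le _
  moves_eq _ _ := rfl
  num_le _ := le_rfl
  lev_le _ := le_rfl
  tokens_eq := by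
    classical
    have h1 : S.filter (fun v => (Core.start (P.deg v) (x v)).alive = false) = ∅ := by
      refine Finset.filter_eq_empty_iff.2 fun v hv => ?_
      simp [Core.start, (hS v).2 hv]
    rw [h1]
    simp [Core.start, hS]

theorem params_bounds {b : ℕ} (hb : 0 < b) :
    (params b).M ≤ 2 ^ (params b).W ∧ (params b).D < 2 ^ (params b).W := by
  have key : ∀ b, 0 < b → 24 * b + 2 ≤ 2 ^ (12 * b) ∧ 832 * b ^ 2 < 2 ^ (12 * b) := by
    intro b hb
    have h1 : b < 2 ^ b := Nat.lt_two_pow_self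
    have h2 : 2 ^ 10 ≤ 2 ^ (10 * b) := Nat.pow_le_pow_right two_pos (by omega)
    have h3 : b ^ 2 < 2 ^ (2 * b) := by
      rw [mul_comm, pow_mul]
      exact Nat.pow_lt_pow_left h1 two_ne_zero
    have h4 : 2 ^ (12 * b) = 2 ^ (10 * b) * 2 ^ (2 * b) := by
      rw [← pow_add]
      congr 1
      ring
    have h5 : b ≤ b ^ 2 := Nat.le_self_pow two_ne_zero b
    have h6 : 1024 * 2 ^ (2 * b) ≤ 2 ^ (12 * b) := by
      rw [h4]
      exact Nat.mul_le_mul_right _ h2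
    omega
  exact key b hb

/-- The algorithm is correct if the messages are wide enough. -/
theorem isBallCarving_run {B b k : ℕ} (hb : 0 < b) (hk : 0 < k) (hw : 73 * b + 2 ≤ k * B)
    (P : PortNumbering G) (hinj : Function.Injective ident) (hident : ∀ v, ident v < 2 ^ b)
    (S : Set V) [DecidablePred (· ∈ S)] :
    IsBallCarving S ((algorithm B b k).run P fun v => ⟨ident v, decide (v ∈ S)⟩)
      (1664 * b ^ 2) (832 * b ^ 2) (24 * b + 2) := by
  have hcard : Fintype.card V ≤ 2 ^ b := by
    simpa using Fintype.card_le_of_injective (fun v => (⟨ident v, hident v⟩ : Fin (2 ^ b)))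
      fun u v h => hinj (congrArg Fin.val h)
  -- The width is `72b + 3`, at most `73b + 2` since `b` is positive.
  have hwidth : (params b).width ≤ k * B := by
    have : (params b).width = 4 * (12 * b) + 1 + (24 * b + 2) := rfl
    omega
  let S' : Finset V := Finset.univ.filter (· ∈ S)
  let x : V → LocalInput := fun v => ⟨ident v, decide (v ∈ S)⟩
  have hS' : ∀ v, (x v).living ↔ v ∈ S' := fun v => by simp [x, S']
  obtain ⟨hMW, hDW⟩ := params_bounds hb
  have hphases : 8 * b * (2 * (52 * b)) = 832 * b ^ 2 := by ring
  obtain ⟨C, hC, hWF, hI, htok⟩ := execList_phases (p := params b) (S := S')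
    (fun v => Node.start (P.deg v) (x v)) (wellFormed_start x fun _ => rfl)
    (invariant_start _ S' x (fun _ => rfl) hS')
    (fun r hr => by
      have : decide (r ∈ S) = true := (hS' r).2 hr
      simp [Node.start, Core.start, x, this])
    hinj (show 0 < 52 * b by omega)
    (by
      change 2 ^ (832 * b ^ 2) * _ < 2 ^ (832 * b ^ 2 + b + 1)
      rw [add_assoc, pow_add]
      refine Nat.mul_lt_mul_of_pos_left (hcard.trans_lt ?_) (Nat.two_pow_pos _)
      exact Nat.pow_lt_pow_right one_lt_two (Nat.lt_succ_self b))
    (fun v => (hident v).trans_le (Nat.pow_le_pow_right two_pos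
      (by change b ≤ 12 * b; omega)))
    hMW hDW (8 * b) (by change 3 * (8 * b) + 2 ≤ 24 * b + 2; omega) hphases.le
  have hrun : ((algorithm B b k).run P fun v => ⟨ident v, decide (v ∈ S)⟩) =
      fun v => (C v).output := by
    funext v
    rw [algorithm, Round.run_compile _ _ _ _ _ hk hwidth, ← hC]
    have : 104 * b = 2 * (params b).h := by
      change 104 * b = 2 * (52 * b)
      ring
    rw [this]
  rw [hrun]
  have hSS : S = (S' : Set V) := by
    ext v
    simp [S']
  rw [hSS]
  refine (isBallCarving_output hb hinj hident hWF hI hcard htok).mono ?_ hphases.le le_rfl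
  have : 8 * b * (2 * (params b).h) = 832 * b ^ 2 := hphases
  omega

end

end BallCarving

theorem mainTheorem2 (c : ℕ) :
    ∃ K : ℕ, ∀ N b B : ℕ,
      ∃ A : CongestAlgorithm B BallCarving.LocalInput BallCarving.LocalOutput,
        ∀ (V : Type*) [Fintype V] (G : SimpleGraph V) (P : PortNumbering G)
          (ident : V → ℕ) (S : Set V) [DecidablePred (· ∈ S)] (n : ℕ),
          Fintype.card V = n → 2 ≤ n →
          n ≤ N → N ≤ n ^ c →
          b ≤ c * Nat.clog 2 n →
          Nat.clog 2 n ≤ c * B →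
          Function.Injective ident → (∀ v, ident v < 2 ^ b) →
            A.rounds ≤ K * Nat.clog 2 n ^ 4 ∧
            BallCarving.IsBallCarving S (A.run P fun v => ⟨ident v, decide (v ∈ S)⟩)
              (K * Nat.clog 2 n ^ 2) (K * Nat.clog 2 n ^ 2) (K * Nat.clog 2 n) := by
  -- A wide message has at most `75b ≤ 75 * c ^ 2 * B` bits, so `75 * c ^ 2` pieces suffice. The
  -- summands of `K` serve the rounds, the radius and diameter, and the overlap, with `b ≤ c * L`.
  refine ⟨75 * c ^ 2 * 1390000 * c ^ 4 + 1664 * c ^ 2 + 26 * c,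
    fun N b B => ⟨BallCarving.algorithm B b (75 * c ^ 2), ?_⟩⟩
  intro V _ G P ident S _ n hn hn2 _ _ hbc hcB hinj hident
  set L := Nat.clog 2 n with hL
  -- Distinct identifiers force `2 ^ b ≥ n ≥ 2`, so `b` is positive.
  have hcard : n ≤ 2 ^ b := by
    rw [← hn]
    simpa using Fintype.card_le_of_injective (fun v => (⟨ident v, hident v⟩ : Fin (2 ^ b)))
      fun u v h => hinj (congrArg Fin.val h)
  have hb : 0 < b := by
    rcases Nat.eq_zero_or_pos b with rfl | hb
    · simp at hcard
      omega
    · exact hb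
  have hc : 0 < c := by
    rcases Nat.eq_zero_or_pos c with rfl | hc
    · omega
    · exact hc
  have hw : 73 * b + 2 ≤ 75 * c ^ 2 * B := by
    have h1 : b ≤ c * (c * B) := hbc.trans (Nat.mul_le_mul_left c hcB)
    calc 73 * b + 2 ≤ 75 * b := by omega
      _ ≤ 75 * (c * (c * B)) := Nat.mul_le_mul_left _ h1
      _ = 75 * c ^ 2 * B := by ring
  have hb2 : b ^ 2 ≤ c ^ 2 * L ^ 2 := by
    rw [← mul_pow]
    exact Nat.pow_le_pow_left hbc 2
  refine ⟨(BallCarving.rounds_algorithm_le B b _).trans ?_,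
    (BallCarving.isBallCarving_run hb (by positivity) hw P hinj hident S).mono ?_ ?_ ?_⟩
  · calc 75 * c ^ 2 * (1390000 * b ^ 4) ≤ 75 * c ^ 2 * (1390000 * (c * L) ^ 4) := by gcongr
      _ = 75 * c ^ 2 * 1390000 * c ^ 4 * L ^ 4 := by ring
      _ ≤ _ := Nat.mul_le_mul_right _ (by omega)
  · calc 1664 * b ^ 2 ≤ 1664 * (c ^ 2 * L ^ 2) := Nat.mul_le_mul_left _ hb2
      _ = 1664 * c ^ 2 * L ^ 2 := by ring
      _ ≤ _ := Nat.mul_le_mul_right _ (by omega)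
  · calc 832 * b ^ 2 ≤ 1664 * (c ^ 2 * L ^ 2) := Nat.mul_le_mul (by norm_num) hb2
      _ = 1664 * c ^ 2 * L ^ 2 := by ring
      _ ≤ _ := Nat.mul_le_mul_right _ (by omega)
  · calc 24 * b + 2 ≤ 26 * b := by omega
      _ ≤ 26 * (c * L) := Nat.mul_le_mul_left _ hbc
      _ = 26 * c * L := by ring
      _ ≤ _ := Nat.mul_le_mul_right _ (by omega)
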